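/- Let $\rho>0$, $\alpha\in(0,1)$, $T>0$, $A\in\mathbb{R}^{n\times n}$, $B\in\mathbb{R}^{n\times m}$, $y_0\in\mathbb{R}^n$, and assume that $(s+\rho)^\alpha I-A$ is invertible for all sufficiently large real $s$. Let $u:[0,T]\to\mathbb{R}^m$ be integrable. For an absolutely continuous $v:[0,T]\to\mathbb{R}^n$ define the Caputo tempered derivative $$ {}^TD_0^{\alpha,\rho}v(t)=\frac{1}{\Gamma(1-\alpha)}\int_0^t e^{-\rho(t-s)}(t-s)^{-\alpha}\bigl(\rho v(s)+v'(s)\bigr)\,ds ,$$ and for a square matrix $M$ the Mittag-Leffler matrix functions $$E_\alpha(M)=\sum_{l\ge 0}\frac{M^l}{\Gamma(\alpha l+1)},\qquad E_{\alpha,\alpha}(M)=\sum_{l\ge0}\frac{M^l}{\Gamma(\alpha l+\alpha)} .$$ A solution on $[0,T]$ of the system $${}^TD_0^{\alpha,\rho}y(t)=Ay(t)+Bu(t),\qquad y(0)=y_0, \tag{1}$$ is an absolutely continuous $y:[0,T]\to\mathbb{R}^n$ with $y(0)=y_0$ for which the equation holds (with an absolutely convergent integral on the left) for almost every $t\in[0,T]$.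 Consider the formula $$y(t)=e^{-\rho t}E_\alpha(At^\alpha)y_0+\int_0^t e^{-\rho(t-\tau)}(t-\tau)^{\alpha-1}E_{\alpha,\alpha}\bigl(A(t-\tau)^\alpha\bigr)Bu(\tau)\,d\tau. \tag{2}$$ 1. A function $y:[0,T]\to\mathbb{R}^n$ is a solution of (1) if and only if it is absolutely continuous on $[0,T]$ and, for every $t\in[0,T]$, the integral in (2) converges absolutely and (2) holds. In particular, (1) has at most one solution, and it is given by (2). 2. If $u$ is absolutely continuous on $[0,T]$, then the function defined by (2) is absolutely continuous and is the solution of (1); moreover it satisfies the equation at every $t\in(0,T]$. -/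

import Mathlib

open Matrix MeasureTheory

namespace TemperedFractional

noncomputable section

/-- The one-parameter Mittag-Leffler function of a square matrix,
`E_α(M) = ∑ₗ M ^ l / Γ(α l + 1)`. -/
def mittagLeffler {n : ℕ} (α : ℝ) (M : Matrix (Fin n) (Fin n) ℝ) : Matrix (Fin n) (Fin n) ℝ :=
  ∑' l : ℕ, (Real.Gamma (α * l + 1))⁻¹ • M ^ l

/-- The two-parameter Mittag-Leffler function of a square matrix,
`E_{α,β}(M) = ∑ₗ M ^ l / Γ(α l + β)`. -/
def mittagLeffler₂ {n : ℕ} (α β : ℝ) (M : Matrix (Fin n) (Fin n) ℝ) :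
    Matrix (Fin n) (Fin n) ℝ :=
  ∑' l : ℕ, (Real.Gamma (α * l + β))⁻¹ • M ^ l

/-- The tempered first-order derivative `D^{1,ρ} v = ρ v + v'`. -/
def temperedDeriv {n : ℕ} (ρ : ℝ) (v : ℝ → Fin n → ℝ) (t : ℝ) : Fin n → ℝ :=
  ρ • v t + deriv v t

/-- The integrand `s ↦ e^{-ρ(t-s)} (t-s)^{-α} D^{1,ρ} v(s)` of the Caputo tempered derivative. -/
def caputoIntegrand {n : ℕ} (α ρ : ℝ) (v : ℝ → Fin n → ℝ) (t s : ℝ) : Fin n → ℝ :=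
  (Real.exp (-ρ * (t - s)) * (t - s) ^ (-α)) • temperedDeriv ρ v s

/-- The Caputo tempered fractional derivative of order `α ∈ (0,1)` with base point `0`,
`(1 / Γ(1-α)) ∫₀ᵗ e^{-ρ(t-s)} (t-s)^{-α} D^{1,ρ} v(s) ds`. -/
def caputoTempered {n : ℕ} (α ρ : ℝ) (v : ℝ → Fin n → ℝ) (t : ℝ) : Fin n → ℝ :=
  (Real.Gamma (1 - α))⁻¹ • ∫ s in (0 : ℝ)..t, caputoIntegrand α ρ v t s

/-- At time `t` the integral defining the Caputo tempered derivative of `v` converges absolutely,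
and the derivative equals `d`. -/
def HasCaputoTempered {n : ℕ} (α ρ : ℝ) (v : ℝ → Fin n → ℝ) (t : ℝ) (d : Fin n → ℝ) : Prop :=
  IntervalIntegrable (caputoIntegrand α ρ v t) volume 0 t ∧ caputoTempered α ρ v t = d

/-- `y` is a solution on `[0,T]` of `D^{α,ρ} y = A y + B u`, `y(0) = y₀`: it is absolutely
continuous on `[0,T]`, has the prescribed initial value, and satisfies the equation at almost every
time. (Functions are defined on `ℝ`, but only their values on `[0,T]` matter.) -/
structure IsSolution {n m : ℕ} (α ρ T : ℝ) (A : Matrix (Fin n) (Fin n) ℝ)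
    (B : Matrix (Fin n) (Fin m) ℝ) (u : ℝ → Fin m → ℝ) (y₀ : Fin n → ℝ)
    (y : ℝ → Fin n → ℝ) : Prop where
  absolutelyContinuous : AbsolutelyContinuousOnInterval y 0 T
  initial : y 0 = y₀
  equation : ∀ᵐ t ∂(volume.restrict (Set.Icc 0 T)),
    HasCaputoTempered α ρ y t (A *ᵥ y t + B *ᵥ u t)

/-- The integrand `τ ↦ e^{-ρ(t-τ)} (t-τ)^{α-1} E_{α,α}(A (t-τ)^α) B u(τ)`. -/
def forcingIntegrand {n m : ℕ} (α ρ : ℝ) (A : Matrix (Fin n) (Fin n) ℝ)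
    (B : Matrix (Fin n) (Fin m) ℝ) (u : ℝ → Fin m → ℝ) (t τ : ℝ) : Fin n → ℝ :=
  (Real.exp (-ρ * (t - τ)) * (t - τ) ^ (α - 1)) •
    (mittagLeffler₂ α α ((t - τ) ^ α • A) *ᵥ (B *ᵥ u τ))

/-- The variation of constants formula
`e^{-ρt} E_α(A t^α) y₀ + ∫₀ᵗ e^{-ρ(t-τ)} (t-τ)^{α-1} E_{α,α}(A (t-τ)^α) B u(τ) dτ`. -/
def solutionFormula {n m : ℕ} (α ρ : ℝ) (A : Matrix (Fin n) (Fin n) ℝ)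
    (B : Matrix (Fin n) (Fin m) ℝ) (u : ℝ → Fin m → ℝ) (y₀ : Fin n → ℝ) (t : ℝ) : Fin n → ℝ :=
  Real.exp (-ρ * t) • (mittagLeffler α (t ^ α • A) *ᵥ y₀) +
    ∫ τ in (0 : ℝ)..t, forcingIntegrand α ρ A B u t τ

end

end TemperedFractional

namespace TemperedFractional

open Set Filter Topology intervalIntegral

/-! Write `k_β(x) = e^{-ρx} x^{β-1} / Γ(β)` for `x > 0` and `D y = ρ y + y'`. A function `y` is
absolutely continuous exactly when `y = k_1 y₀ + k_1 * f` with `f` integrable, and then `f = D y`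
a.e.; its Caputo derivative is `k_{1-α} * f`. The Beta integral gives `k_β * k_γ = k_{β+γ}`. For
`E_β = ∑ A^l k_{αl+β}` it follows that `k_γ * E_β = E_{β+γ}`, while splitting off the term `l = 0`
gives `E_β = k_β + A E_{β+α}`. Formula (2) reads `y = E_1 y₀ + E_α * Bu`.

Solutions obey (2): convolving the equation with `E_α` turns `k_{1-α} * f` into `E_1 * f`, and the
two kernel identities reduce the result to `y - E_1 y₀ = E_α * Bu` (`conv_mlKer_conv_powOp`).
Conversely, if (2) holds, the residual `r = k_{1-α} * f - Ay - Bu` satisfies `E_α * r = 0`. Then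
`E_1 * r` and `E_{1+α} * r` vanish, hence so does `k_1 * r = E_1 * r - A E_{1+α} * r`, and
differentiation gives `r = 0` a.e. (`ae_eq_zero_of_conv_mlKer_eq_zero`).

If `u` is absolutely continuous, `Bu = k_1 g₀ + k_1 * φ`, and the same identities show that (2)
equals `k_1 y₀ + k_1 * F` with `F = E_α (A y₀ + g₀) + E_α * φ` (`conv_mlKer_of_eq_conv_powOp`). All
this must hold at every time for merely integrable `f`, which is the role of the bounded absolute
convolutions in `IsKernelConv`. -/

/-! ### Vector-valued absolutely continuous functions. -/

lemma AbsolutelyContinuousOnInterval.lipschitz_comp {X Y : Type*} [PseudoMetricSpace X]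
    [PseudoMetricSpace Y] {f : ℝ → X} {a b : ℝ} (hf : AbsolutelyContinuousOnInterval f a b)
    {K : NNReal} {g : X → Y} (hg : LipschitzWith K g) :
    AbsolutelyContinuousOnInterval (fun t => g (f t)) a b := by
  have h := Filter.Tendsto.const_mul (K : ℝ) hf
  rw [mul_zero] at h
  refine squeeze_zero (fun _ => Finset.sum_nonneg fun _ _ => dist_nonneg) (fun E => ?_) h
  rw [Finset.mul_sum]
  exact Finset.sum_le_sum fun i _ => hg.dist_le_mul _ _

lemma AbsolutelyContinuousOnInterval.pi {ι : Type*} [Fintype ι] {f : ℝ → ι → ℝ} {a b : ℝ}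
    (hf : ∀ i, AbsolutelyContinuousOnInterval (fun t => f t i) a b) :
    AbsolutelyContinuousOnInterval f a b := by
  have h := tendsto_finsetSum (Finset.univ : Finset ι) fun i _ => hf i
  rw [Finset.sum_const_zero] at h
  refine squeeze_zero (fun _ => Finset.sum_nonneg fun _ _ => dist_nonneg) (fun E => ?_) h
  rw [Finset.sum_comm]
  refine Finset.sum_le_sum fun i _ => ?_
  refine (dist_pi_le_iff (Finset.sum_nonneg fun _ _ => dist_nonneg)).2 fun j => ?_
  exact Finset.single_le_sum (f := fun j => dist (f (E.2 i).1 j) (f (E.2 i).2 j))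
    (fun _ _ => dist_nonneg) (Finset.mem_univ j)

lemma AbsolutelyContinuousOnInterval.eval {ι : Type*} [Fintype ι] {f : ℝ → ι → ℝ} {a b : ℝ}
    (hf : AbsolutelyContinuousOnInterval f a b) (i : ι) :
    AbsolutelyContinuousOnInterval (fun t => f t i) a b :=
  AbsolutelyContinuousOnInterval.lipschitz_comp hf (LipschitzWith.eval i)

lemma AbsolutelyContinuousOnInterval.congr {X : Type*} [PseudoMetricSpace X] {f g : ℝ → X}
    {a b : ℝ} (hf : AbsolutelyContinuousOnInterval f a b) (h : EqOn f g (uIcc a b)) :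
    AbsolutelyContinuousOnInterval g a b := by
  refine Tendsto.congr' ?_ hf
  refine (eventually_inf_principal.2 (Eventually.of_forall fun E hE => ?_))
  refine Finset.sum_congr rfl fun i hi => ?_
  rw [h (hE.1 i hi).1, h (hE.1 i hi).2]

lemma AbsolutelyContinuousOnInterval.ae_differentiableAt_pi {ι : Type*} [Fintype ι]
    {f : ℝ → ι → ℝ} {a b : ℝ} (hf : AbsolutelyContinuousOnInterval f a b) :
    ∀ᵐ x : ℝ, x ∈ uIcc a b → DifferentiableAt ℝ f x := by
  have h : ∀ᵐ x : ℝ, ∀ i, x ∈ uIcc a b → DifferentiableAt ℝ (fun t => f t i) x :=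
    ae_all_iff.2 fun i => (AbsolutelyContinuousOnInterval.eval hf i).ae_differentiableAt
  filter_upwards [h] with x hx hxab
  exact differentiableAt_pi.2 fun i => hx i hxab

lemma intervalIntegrable_pi {ι : Type*} [Fintype ι] {f : ℝ → ι → ℝ} {a b : ℝ}
    (hf : ∀ i, IntervalIntegrable (fun t => f t i) volume a b) :
    IntervalIntegrable f volume a b :=
  ⟨Integrable.of_eval fun i => (hf i).1, Integrable.of_eval fun i => (hf i).2⟩

lemma intervalIntegral_eval {ι : Type*} [Fintype ι] {f : ℝ → ι → ℝ} {a b : ℝ}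
    (hf : IntervalIntegrable f volume a b) (i : ι) :
    (∫ t in a..b, f t) i = ∫ t in a..b, f t i :=
  ((ContinuousLinearMap.proj (R := ℝ) (φ := fun _ : ι => ℝ) i).intervalIntegral_comp_comm hf).symm

/-- Fundamental theorem of calculus for vector-valued absolutely continuous functions. -/
lemma AbsolutelyContinuousOnInterval.integral_eq_sub_of_ae_hasDerivAt {ι : Type*} [Fintype ι]
    {f F : ℝ → ι → ℝ} {a b : ℝ} (hf : AbsolutelyContinuousOnInterval f a b)
    (hF : ∀ᵐ x : ℝ, x ∈ uIcc a b → HasDerivAt f (F x) x) :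
    IntervalIntegrable F volume a b ∧ ∫ x in a..b, F x = f b - f a := by
  have hFi : ∀ i, ∀ᵐ x : ℝ, x ∈ uIoc a b → deriv (fun t => f t i) x = F x i := fun i => by
    filter_upwards [hF] with x hx hxab
    exact (hasDerivAt_pi.1 (hx (uIoc_subset_uIcc hxab)) i).deriv
  have hint : IntervalIntegrable F volume a b := intervalIntegrable_pi fun i =>
    (AbsolutelyContinuousOnInterval.eval hf i).intervalIntegrable_deriv.congr_ae
      ((ae_restrict_iff' measurableSet_uIoc).2 (hFi i))
  refine ⟨hint, funext fun i => ?_⟩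
  rw [intervalIntegral_eval hint, ← integral_congr_ae (hFi i),
    (AbsolutelyContinuousOnInterval.eval hf i).integral_deriv_eq_sub]
  rfl

lemma absolutelyContinuousOnInterval_integral {ι : Type*} [Fintype ι] {F : ℝ → ι → ℝ} {T : ℝ}
    (hF : IntervalIntegrable F volume 0 T) :
    AbsolutelyContinuousOnInterval (fun x => ∫ t in (0 : ℝ)..x, F t) 0 T := by
  refine AbsolutelyContinuousOnInterval.pi fun i => ?_
  have hFi : IntervalIntegrable (fun t => F t i) volume 0 T :=
    ⟨hF.1.eval i, hF.2.eval i⟩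
  refine AbsolutelyContinuousOnInterval.congr
    (hFi.absolutelyContinuousOnInterval_intervalIntegral (c := 0) left_mem_uIcc) fun x hx => ?_
  refine (intervalIntegral_eval (hF.mono_set ?_) i).symm
  exact uIcc_subset_uIcc_left hx

lemma ae_eq_zero_of_forall_integral_eq_zero {E : Type*} [NormedAddCommGroup E] [NormedSpace ℝ E]
    [CompleteSpace E] {r : ℝ → E} {T : ℝ} (hT : 0 ≤ T) (hr : IntervalIntegrable r volume 0 T)
    (h : ∀ t ∈ Ioc 0 T, ∫ s in (0 : ℝ)..t, r s = 0) :
    ∀ᵐ t : ℝ, t ∈ Ioc 0 T → r t = 0 := by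
  -- Lebesgue differentiation of the vanishing primitive; `T` is excluded so that `Ioc 0 T` is a
  -- neighbourhood of `t`.
  filter_upwards [hr.ae_hasDerivAt_integral, (by simp [ae_iff] : ∀ᵐ x : ℝ, x ≠ T)]
    with t ht htT htm
  have h1 := ht (by rw [uIcc_of_le hT]; exact Ioc_subset_Icc_self htm) 0 left_mem_uIcc
  have h2 : (fun x => ∫ s in (0 : ℝ)..x, r s) =ᶠ[𝓝 t] fun _ => 0 := by
    filter_upwards [Ioc_mem_nhds htm.1 (lt_of_le_of_ne htm.2 htT)] with x hx using h x hx
  exact h1.unique ((hasDerivAt_const t (0 : E)).congr_of_eventuallyEq h2)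

/-! ### The first-order tempered derivative and its inverse. -/

lemma absolutelyContinuousOnInterval_exp (ρ a b : ℝ) :
    AbsolutelyContinuousOnInterval (fun t => Real.exp (ρ * t)) a b :=
  ContDiffOn.absolutelyContinuousOnInterval (by fun_prop)

lemma hasDerivAt_exp_mul (ρ t : ℝ) :
    HasDerivAt (fun t => Real.exp (ρ * t)) (Real.exp (ρ * t) * ρ) t := by
  simpa using ((hasDerivAt_id t).const_mul ρ).exp

lemma intervalIntegrable_exp_smul {E : Type*} [NormedAddCommGroup E] [NormedSpace ℝ E]
    {f : ℝ → E} {a b : ℝ} (ρ : ℝ) (hf : IntervalIntegrable f volume a b) :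
    IntervalIntegrable (fun s => Real.exp (ρ * s) • f s) volume a b :=
  hf.continuousOn_smul (by fun_prop)

lemma exp_smul_integral {E : Type*} [NormedAddCommGroup E] [NormedSpace ℝ E]
    (f : ℝ → E) (ρ a t : ℝ) :
    ∫ s in a..t, Real.exp (-ρ * (t - s)) • f s
      = Real.exp (-ρ * t) • ∫ s in a..t, Real.exp (ρ * s) • f s := by
  rw [← intervalIntegral.integral_smul]
  refine integral_congr fun s _ => ?_
  simp only [smul_smul, ← Real.exp_add]
  ring_nf

/-- The variation of constants formula for `D^{1,ρ}`. -/
lemma AbsolutelyContinuousOnInterval.eq_integral_temperedDeriv {n : ℕ} {y : ℝ → Fin n → ℝ}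
    {T : ℝ} (ρ : ℝ) (hy : AbsolutelyContinuousOnInterval y 0 T) :
    IntervalIntegrable (temperedDeriv ρ y) volume 0 T ∧ ∀ t ∈ Icc 0 T,
      y t = Real.exp (-ρ * t) • y 0
        + ∫ s in (0 : ℝ)..t, Real.exp (-ρ * (t - s)) • temperedDeriv ρ y s := by
  have hz : AbsolutelyContinuousOnInterval (fun t => Real.exp (ρ * t) • y t) 0 T :=
    (absolutelyContinuousOnInterval_exp ρ 0 T).smul hy
  -- The integrating factor `e^{ρt}` turns the tempered derivative into an ordinary one.
  have hd : ∀ᵐ x : ℝ, x ∈ uIcc 0 T → HasDerivAt (fun t => Real.exp (ρ * t) • y t)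
      (Real.exp (ρ * x) • temperedDeriv ρ y x) x := by
    filter_upwards [AbsolutelyContinuousOnInterval.ae_differentiableAt_pi hy] with x hx hxT
    refine ((hasDerivAt_exp_mul ρ x).smul (hx hxT).hasDerivAt).congr_deriv ?_
    rw [add_comm, mul_smul, ← smul_add]
    rfl
  refine ⟨?_, fun t ht => ?_⟩
  · have := intervalIntegrable_exp_smul (-ρ)
      (AbsolutelyContinuousOnInterval.integral_eq_sub_of_ae_hasDerivAt hz hd).1
    refine this.congr (fun s _ => ?_)
    simp [smul_smul, ← Real.exp_add]
  · have hsub : uIcc 0 t ⊆ uIcc 0 T := by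
      rw [uIcc_of_le ht.1, uIcc_of_le (ht.1.trans ht.2)]; exact Icc_subset_Icc_right ht.2
    have := (AbsolutelyContinuousOnInterval.integral_eq_sub_of_ae_hasDerivAt (hz.mono hsub)
      (hd.mono fun x hx h => hx (hsub h))).2
    rw [exp_smul_integral, this]
    simp [smul_sub, smul_smul, ← Real.exp_add]

/-- Converse of `AbsolutelyContinuousOnInterval.eq_integral_temperedDeriv`: `e^{ρt} y` is a constant
plus the primitive of `e^{ρs} F`. -/
lemma temperedDeriv_of_eq_integral {n : ℕ} {y F : ℝ → Fin n → ℝ} {y₀ : Fin n → ℝ} {T : ℝ} (ρ : ℝ)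
    (hT : 0 ≤ T) (hF : IntervalIntegrable F volume 0 T)
    (hy : ∀ t ∈ Icc 0 T, y t = Real.exp (-ρ * t) • y₀
      + ∫ s in (0 : ℝ)..t, Real.exp (-ρ * (t - s)) • F s) :
    AbsolutelyContinuousOnInterval y 0 T ∧
      ∀ᵐ t : ℝ, t ∈ Ioc 0 T → temperedDeriv ρ y t = F t := by
  have hG := intervalIntegrable_exp_smul ρ hF
  have hy' : EqOn (fun t => Real.exp (-ρ * t) • (y₀ + ∫ s in (0 : ℝ)..t, Real.exp (ρ * s) • F s))
      y (Icc 0 T) := fun t ht => by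
    simp only [hy t ht, exp_smul_integral, smul_add]
  have hconst : AbsolutelyContinuousOnInterval (fun _ : ℝ => y₀) 0 T :=
    ContDiffOn.absolutelyContinuousOnInterval (by fun_prop)
  constructor
  · refine AbsolutelyContinuousOnInterval.congr
      ((absolutelyContinuousOnInterval_exp (-ρ) 0 T).smul
        (hconst.add (absolutelyContinuousOnInterval_integral hG))) ?_
    rw [uIcc_of_le hT]
    exact hy'
  · filter_upwards [hG.ae_hasDerivAt_integral, (by simp [ae_iff] : ∀ᵐ x : ℝ, x ≠ T)]
      with t ht htT htm
    have h1 := ht (by rw [uIcc_of_le hT]; exact Ioc_subset_Icc_self htm) 0 left_mem_uIcc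
    have h2 := (hasDerivAt_exp_mul (-ρ) t).smul (h1.const_add y₀)
    have h3 : HasDerivAt y _ t := h2.congr_of_eventuallyEq (by
      filter_upwards [Ioc_mem_nhds htm.1 (lt_of_le_of_ne htm.2 htT)] with x hx
      exact (hy' (Ioc_subset_Icc_self hx)).symm)
    rw [temperedDeriv, h3.deriv, ← hy' (Ioc_subset_Icc_self htm)]
    simp only [smul_smul, ← Real.exp_add]
    simp only [neg_mul, neg_add_cancel, Real.exp_zero, one_smul, mul_neg, neg_smul]
    rw [mul_comm ρ]
    abel

/-! ### Growth of Gamma and convergence of the Mittag-Leffler series. -/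

section

/-- Log-convexity of Gamma: the slope of `log Γ` on `[x, x+α]` is at least its slope on `[x-1, x]`,
which is `log (x-1)` by the functional equation. So the quotient is at least `(x-1)^α`. -/
lemma tendsto_Gamma_add_div_Gamma {α : ℝ} (hα : 0 < α) :
    Tendsto (fun x : ℝ => Real.Gamma (x + α) / Real.Gamma x) atTop atTop := by
  have h1 : Tendsto (fun x : ℝ => (x - 1) ^ α) atTop atTop :=
    (tendsto_rpow_atTop hα).comp (tendsto_atTop_add_const_right _ _ tendsto_id)
  refine tendsto_atTop_mono' _ ?_ h1
  filter_upwards [eventually_gt_atTop 1] with x hx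
  have hx0 : 0 < x - 1 := by linarith
  have hG : ∀ {z : ℝ}, 0 < z → 0 < Real.Gamma z := fun h => Real.Gamma_pos_of_pos h
  have hs := Real.convexOn_log_Gamma.slope_mono_adjacent (x := x - 1) (y := x) (z := x + α)
    hx0 (show 0 < x + α by linarith) (by linarith) (by linarith)
  have hrec : Real.Gamma x = (x - 1) * Real.Gamma (x - 1) := by
    have := Real.Gamma_add_one hx0.ne'
    rwa [sub_add_cancel] at this
  simp only [Function.comp_apply, sub_sub_cancel, div_one, add_sub_cancel_left] at hs
  have hlog : Real.log (Real.Gamma x) - Real.log (Real.Gamma (x - 1)) = Real.log (x - 1) := by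
    rw [hrec, Real.log_mul hx0.ne' (hG hx0).ne', add_sub_cancel_right]
  rw [hlog, le_div_iff₀ hα,
    ← Real.log_div (hG (by linarith)).ne' (hG (by linarith)).ne'] at hs
  rw [Real.rpow_def_of_pos hx0]
  exact (Real.le_log_iff_exp_le (div_pos (hG (by linarith)) (hG (by linarith)))).1 hs

lemma summable_pow_div_Gamma {α β : ℝ} (hα : 0 < α) (hβ : 0 < β) (x : ℝ) :
    Summable fun l : ℕ => x ^ l / Real.Gamma (α * l + β) := by
  rcases eq_or_ne x 0 with rfl | hx
  · refine summable_of_ne_finset_zero (s := {0}) fun l hl => ?_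
    simp [zero_pow (by simpa using hl : l ≠ 0)]
  have hG : ∀ l : ℕ, 0 < Real.Gamma (α * l + β) := fun l => Real.Gamma_pos_of_pos (by positivity)
  refine summable_of_ratio_test_tendsto_lt_one (l := 0) one_pos
    (Eventually.of_forall fun l => div_ne_zero (pow_ne_zero _ hx) (hG l).ne') ?_
  have hlin : Tendsto (fun l : ℕ => α * (l : ℝ) + β) atTop atTop :=
    tendsto_atTop_add_const_right _ _ (tendsto_natCast_atTop_atTop.const_mul_atTop hα)
  have h := ((tendsto_Gamma_add_div_Gamma hα).comp hlin).inv_tendsto_atTop.const_mul |x|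
  rw [mul_zero] at h
  refine h.congr fun l => ?_
  have e : α * ((l + 1 : ℕ) : ℝ) + β = α * l + β + α := by push_cast; ring
  have hG' : 0 < Real.Gamma (α * l + β + α) := by rw [← e]; exact hG _
  have := hG l
  rw [e, Real.norm_eq_abs, Real.norm_eq_abs, abs_div, abs_div, abs_of_pos this, abs_of_pos hG',
    abs_pow, abs_pow, pow_succ]
  have : |x| ^ l ≠ 0 := pow_ne_zero _ (abs_ne_zero.2 hx)
  simp only [Function.comp_apply, Pi.inv_apply]
  field_simp

/-! ### Tempered power kernels and their convolution semigroup. -/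

/-- The tempered power kernel `e^{-ρx} x^{β-1} / Γ(β)`, extended by zero to `x ≤ 0`. -/
noncomputable def powKer (ρ β x : ℝ) : ℝ :=
  if 0 < x then Real.exp (-ρ * x) * x ^ (β - 1) / Real.Gamma β else 0

lemma powKer_of_pos (ρ β : ℝ) {x : ℝ} (hx : 0 < x) :
    powKer ρ β x = Real.exp (-ρ * x) * x ^ (β - 1) / Real.Gamma β := if_pos hx

lemma powKer_of_nonpos (ρ β : ℝ) {x : ℝ} (hx : x ≤ 0) : powKer ρ β x = 0 := if_neg hx.not_gt

lemma powKer_one (ρ : ℝ) {x : ℝ} (hx : 0 < x) : powKer ρ 1 x = Real.exp (-ρ * x) := by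
  simp [powKer_of_pos ρ 1 hx]

lemma powKer_pos (ρ : ℝ) {β x : ℝ} (hβ : 0 < β) (hx : 0 < x) : 0 < powKer ρ β x := by
  rw [powKer_of_pos ρ β hx]
  have := Real.Gamma_pos_of_pos hβ
  positivity

lemma powKer_nonneg (ρ : ℝ) {β : ℝ} (hβ : 0 < β) (x : ℝ) : 0 ≤ powKer ρ β x := by
  rcases lt_or_ge 0 x with hx | hx
  · exact (powKer_pos ρ hβ hx).le
  · rw [powKer_of_nonpos ρ β hx]

lemma measurable_powKer (ρ β : ℝ) : Measurable (powKer ρ β) := by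
  unfold powKer
  exact Measurable.ite measurableSet_Ioi (by fun_prop) measurable_const

/-- For `β ≥ 1` the kernel has no singularity at `0`; this is the source of all bounds uniform in
time. -/
lemma powKer_le {ρ β t T : ℝ} (hρ : 0 ≤ ρ) (hβ : 1 ≤ β) (ht : 0 < t) (htT : t ≤ T) :
    powKer ρ β t ≤ powKer 0 β T := by
  rw [powKer_of_pos ρ β ht, powKer_of_pos 0 β (ht.trans_le htT)]
  have := Real.Gamma_pos_of_pos (zero_lt_one.trans_le hβ)
  have h1 : Real.exp (-ρ * t) ≤ Real.exp (-0 * T) := Real.exp_le_exp.2 (by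
    rw [neg_zero, zero_mul]; nlinarith)
  have h2 : t ^ (β - 1) ≤ T ^ (β - 1) := Real.rpow_le_rpow ht.le htT (by linarith)
  gcongr

lemma integral_rpow_mul_rpow_sub {β γ t : ℝ} (hβ : 0 < β) (hγ : 0 < γ) (ht : 0 < t) :
    ∫ s in (0 : ℝ)..t, s ^ (β - 1) * (t - s) ^ (γ - 1)
      = t ^ (β + γ - 1) * (Real.Gamma β * Real.Gamma γ / Real.Gamma (β + γ)) := by
  have h := Complex.betaIntegral_scaled (β : ℂ) (γ : ℂ) ht
  rw [Complex.betaIntegral_eq_Gamma_mul_div _ _ (by simpa) (by simpa)] at h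
  apply Complex.ofReal_injective
  rw [← intervalIntegral.integral_ofReal]
  refine (Eq.trans (integral_congr fun s hs => ?_) h).trans ?_
  · rw [uIcc_of_le ht.le] at hs
    simp only [Complex.ofReal_mul]
    rw [Complex.ofReal_cpow hs.1, Complex.ofReal_cpow (sub_nonneg.2 hs.2)]
    push_cast
    rfl
  · push_cast
    rw [Complex.ofReal_cpow ht.le, ← Complex.Gamma_ofReal, ← Complex.Gamma_ofReal,
      ← Complex.Gamma_ofReal]
    push_cast
    rfl

/-- The convolution of two power kernels is a power kernel. -/
lemma integral_powKer_mul (ρ : ℝ) {β γ t : ℝ} (hβ : 0 < β) (hγ : 0 < γ) (ht : 0 < t) :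
    ∫ s in (0 : ℝ)..t, powKer ρ γ (t - s) * powKer ρ β s = powKer ρ (β + γ) t := by
  have hG := Real.Gamma_pos_of_pos hβ
  have hG' := Real.Gamma_pos_of_pos hγ
  have h : ∫ s in (0 : ℝ)..t, powKer ρ γ (t - s) * powKer ρ β s =
      ∫ s in (0 : ℝ)..t, (Real.exp (-ρ * t) / (Real.Gamma γ * Real.Gamma β)) *
        (s ^ (β - 1) * (t - s) ^ (γ - 1)) := by
    refine integral_congr_ae ?_
    filter_upwards [(by simp [ae_iff] : ∀ᵐ x : ℝ, x ≠ t)] with s hs hst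
    rw [uIoc_of_le ht.le] at hst
    rw [powKer_of_pos _ _ hst.1, powKer_of_pos _ _ (sub_pos.2 (lt_of_le_of_ne hst.2 hs)),
      show -ρ * t = -ρ * (t - s) + -ρ * s by ring, Real.exp_add]
    field_simp
  rw [h, intervalIntegral.integral_const_mul, integral_rpow_mul_rpow_sub hβ hγ ht,
    powKer_of_pos _ _ ht]
  field_simp

lemma intervalIntegrable_powKer_mul (ρ : ℝ) {β γ t : ℝ} (hβ : 0 < β) (hγ : 0 < γ) (ht : 0 < t) :
    IntervalIntegrable (fun s => powKer ρ γ (t - s) * powKer ρ β s) volume 0 t :=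
  -- A non-integrable function has integral `0` by convention, so a nonzero value forces
  -- integrability.
  intervalIntegrable_of_integral_ne_zero (by
    rw [integral_powKer_mul ρ hβ hγ ht]
    exact (powKer_pos ρ (by positivity) ht).ne')

/-- Assuming only `‖1‖ ≤ 1` admits the zero algebra, which occurs for operators when `n = 0`. -/
lemma norm_pow_le_pow_norm {𝔸 : Type*} [NormedRing 𝔸] (h1 : ‖(1 : 𝔸)‖ ≤ 1) (S : 𝔸) (l : ℕ) : ‖S ^ l‖ ≤ ‖S‖ ^ l := by
  rcases l.eq_zero_or_pos with rfl | hl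
  · simpa using h1
  · exact norm_pow_le' S hl

/-! ### Mittag-Leffler kernels in a normed algebra. -/

section NormedAlgebra

variable {𝔸 : Type*} [NormedRing 𝔸] [NormedAlgebra ℝ 𝔸]

/-- The tempered Mittag-Leffler kernel `e^{-ρx} x^{β-1} E_{α,β}(S x^α)`, extended by zero. -/
noncomputable def mlKer (ρ α : ℝ) (S : 𝔸) (β x : ℝ) : 𝔸 :=
  ∑' l : ℕ, powKer ρ (α * l + β) x • S ^ l

variable {ρ α β γ : ℝ}

lemma mlKer_of_nonpos (ρ α : ℝ) (S : 𝔸) (β : ℝ) {x : ℝ} (hx : x ≤ 0) : mlKer ρ α S β x = 0 := by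
  simp [mlKer, powKer_of_nonpos _ _ hx]

lemma summable_powKer_mul_pow (ρ : ℝ) (hα : 0 < α) (hβ : 0 < β) (a x : ℝ) :
    Summable fun l : ℕ => powKer ρ (α * l + β) x * a ^ l := by
  rcases le_or_gt x 0 with hx | hx
  · simp [powKer_of_nonpos _ _ hx, summable_zero]
  refine ((summable_pow_div_Gamma hα hβ (x ^ α * a)).mul_left
    (Real.exp (-ρ * x) * x ^ (β - 1))).congr fun l => ?_
  rw [powKer_of_pos _ _ hx, show α * l + β - 1 = (β - 1) + α * l by ring, Real.rpow_add hx,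
    Real.rpow_mul hx.le, Real.rpow_natCast, mul_pow]
  ring

lemma norm_powKer_smul_le (h1 : ‖(1 : 𝔸)‖ ≤ 1) (ρ : ℝ) (hβ : 0 < β) (S : 𝔸) (x : ℝ) (l : ℕ) :
    ‖powKer ρ β x • S ^ l‖ ≤ powKer ρ β x * ‖S‖ ^ l := by
  rw [norm_smul, Real.norm_of_nonneg (powKer_nonneg ρ hβ x)]
  exact mul_le_mul_of_nonneg_left (norm_pow_le_pow_norm h1 S l) (powKer_nonneg ρ hβ x)

lemma norm_mlKer_le (h1 : ‖(1 : 𝔸)‖ ≤ 1) (ρ : ℝ) (hα : 0 < α) (hβ : 0 < β) (S : 𝔸) (x : ℝ) :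
    ‖mlKer ρ α S β x‖ ≤ mlKer ρ α ‖S‖ β x :=
  tsum_of_norm_bounded (summable_powKer_mul_pow ρ hα hβ ‖S‖ x).hasSum
    fun l => norm_powKer_smul_le h1 ρ (by positivity) S x l

variable [CompleteSpace 𝔸]

lemma summable_powKer_smul_pow (h1 : ‖(1 : 𝔸)‖ ≤ 1) (ρ : ℝ) (hα : 0 < α) (hβ : 0 < β) (S : 𝔸)
    (x : ℝ) : Summable fun l : ℕ => powKer ρ (α * l + β) x • S ^ l :=
  Summable.of_norm_bounded (summable_powKer_mul_pow ρ hα hβ ‖S‖ x)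
    fun l => norm_powKer_smul_le h1 ρ (by positivity) S x l

lemma stronglyMeasurable_mlKer (h1 : ‖(1 : 𝔸)‖ ≤ 1) (ρ : ℝ) (hα : 0 < α) (hβ : 0 < β) (S : 𝔸) :
    StronglyMeasurable (mlKer ρ α S β) := by
  refine stronglyMeasurable_of_tendsto (f := fun (N : ℕ) x =>
    ∑ l ∈ Finset.range N, powKer ρ (α * l + β) x • S ^ l) atTop (fun N => ?_)
    (tendsto_pi_nhds.2 fun x => (summable_powKer_smul_pow h1 ρ hα hβ S x).hasSum.tendsto_sum_nat)
  exact Finset.stronglyMeasurable_fun_sum _ fun l _ =>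
    (measurable_powKer _ _).stronglyMeasurable.smul stronglyMeasurable_const

/-- Splits off the term `l = 0` and reindexes the tail: this is the resolvent identity behind the
whole argument. -/
lemma mlKer_eq_add (h1 : ‖(1 : 𝔸)‖ ≤ 1) (ρ : ℝ) (hα : 0 < α) (hβ : 0 < β) (S : 𝔸) (x : ℝ) :
    mlKer ρ α S β x = powKer ρ β x • 1 + S * mlKer ρ α S (β + α) x := by
  rw [mlKer, (summable_powKer_smul_pow h1 ρ hα hβ S x).tsum_eq_zero_add, mlKer,
    ← (summable_powKer_smul_pow h1 ρ hα (add_pos hβ hα) S x).tsum_mul_left]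
  congr 1
  · simp
  · refine tsum_congr fun l => ?_
    rw [mul_smul_comm, ← pow_succ']
    push_cast
    ring_nf

lemma commute_mlKer (h1 : ‖(1 : 𝔸)‖ ≤ 1) (ρ : ℝ) (hα : 0 < α) (hβ : 0 < β) (S : 𝔸) (x : ℝ) :
    S * mlKer ρ α S β x = mlKer ρ α S β x * S := by
  have hs := summable_powKer_smul_pow h1 ρ hα hβ S x
  rw [mlKer, ← hs.tsum_mul_left, ← hs.tsum_mul_right]
  refine tsum_congr fun l => ?_
  rw [mul_smul_comm, smul_mul_assoc, ← pow_succ, ← pow_succ']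

/-- Termwise, this is the semigroup law of the power kernels. Sum and integral may be exchanged
because the integrals of the norms are dominated by the scalar series with `‖S‖` at `β + γ`. -/
lemma integral_powKer_smul_mlKer (h1 : ‖(1 : 𝔸)‖ ≤ 1) (ρ : ℝ) (hα : 0 < α) (hβ : 0 < β)
    (hγ : 0 < γ) (S : 𝔸) {t : ℝ} (ht : 0 < t) :
    ∫ s in (0 : ℝ)..t, powKer ρ γ (t - s) • mlKer ρ α S β s = mlKer ρ α S (β + γ) t := by
  have hpos : ∀ l : ℕ, 0 < α * l + β := fun l => by positivity
  have hF : ∀ l : ℕ, Integrable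
      (fun s => (powKer ρ γ (t - s) * powKer ρ (α * l + β) s) • S ^ l)
      (volume.restrict (Ioc 0 t)) := fun l =>
    ((intervalIntegrable_iff_integrableOn_Ioc_of_le ht.le).1
      (intervalIntegrable_powKer_mul ρ (hpos l) hγ ht)).smul_const _
  have hI : ∀ l : ℕ, ∫ s in Ioc 0 t, powKer ρ γ (t - s) * powKer ρ (α * l + β) s
      = powKer ρ (α * l + (β + γ)) t := fun l => by
    rw [← integral_of_le ht.le, integral_powKer_mul ρ (hpos l) hγ ht, add_assoc]
  have hsum : Summable fun l : ℕ => ∫ s in Ioc 0 t,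
      ‖(powKer ρ γ (t - s) * powKer ρ (α * l + β) s) • S ^ l‖ := by
    refine Summable.of_nonneg_of_le (fun l => integral_nonneg fun _ => norm_nonneg _) (fun l => ?_)
      (summable_powKer_mul_pow ρ hα (add_pos hβ hγ) ‖S‖ t)
    simp only [norm_smul]
    rw [MeasureTheory.integral_mul_const]
    simp only [Real.norm_of_nonneg (mul_nonneg (powKer_nonneg ρ hγ _)
      (powKer_nonneg ρ (hpos l) _))]
    rw [hI]
    exact mul_le_mul_of_nonneg_left (norm_pow_le_pow_norm h1 S l)
      (powKer_nonneg ρ (by positivity) t)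
  have h := integral_tsum_of_summable_integral_norm hF hsum
  rw [integral_of_le ht.le]
  refine Eq.trans ?_ (h.symm.trans ?_)
  · refine integral_congr_ae (Eventually.of_forall fun s => ?_)
    simp only [mlKer, mul_smul]
    rw [(summable_powKer_smul_pow h1 ρ hα hβ S s).tsum_const_smul]
  · rw [mlKer]
    refine tsum_congr fun l => ?_
    rw [_root_.integral_smul_const, hI]

lemma mlKer_real_pos (ρ : ℝ) (hα : 0 < α) (hβ : 0 < β) {a : ℝ} (ha : 0 ≤ a) {x : ℝ} (hx : 0 < x) :
    0 < mlKer ρ α a β x := by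
  have h0 : ∀ l : ℕ, 0 ≤ powKer ρ (α * l + β) x • a ^ l := fun l =>
    mul_nonneg (powKer_nonneg ρ (by positivity) x) (pow_nonneg ha l)
  refine (summable_powKer_mul_pow ρ hα hβ a x).tsum_pos h0 0 ?_
  simpa using powKer_pos ρ hβ hx

lemma mlKer_real_le {T : ℝ} (hρ : 0 ≤ ρ) (hα : 0 < α) (hβ : 1 ≤ β) {a : ℝ} (ha : 0 ≤ a) {x : ℝ}
    (hx : 0 < x) (hxT : x ≤ T) : mlKer ρ α a β x ≤ mlKer 0 α a β T := by
  refine Summable.tsum_le_tsum (fun l => ?_)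
    (summable_powKer_mul_pow ρ hα (zero_lt_one.trans_le hβ) a x)
    (summable_powKer_mul_pow 0 hα (zero_lt_one.trans_le hβ) a T)
  refine mul_le_mul_of_nonneg_right (powKer_le hρ ?_ hx hxT) (pow_nonneg ha l)
  exact hβ.trans (le_add_of_nonneg_left (by positivity))

/-- The norm is dominated by the scalar kernel with parameter `‖S‖`, whose convolution is known
exactly and is positive, hence integrable. -/
lemma powKer_smul_norm_mlKer (h1 : ‖(1 : 𝔸)‖ ≤ 1) (ρ : ℝ) (hα : 0 < α) (hβ : 0 < β)
    (hγ : 0 < γ) (S : 𝔸) {t : ℝ} (ht : 0 < t) :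
    IntervalIntegrable (fun s => powKer ρ γ (t - s) * ‖mlKer ρ α S β s‖) volume 0 t ∧
    ∫ s in (0 : ℝ)..t, powKer ρ γ (t - s) * ‖mlKer ρ α S β s‖ ≤ mlKer ρ α ‖S‖ (β + γ) t := by
  have h1' : ‖(1 : ℝ)‖ ≤ 1 := by simp
  have hI := integral_powKer_smul_mlKer h1' ρ hα hβ hγ ‖S‖ ht
  have hint : IntervalIntegrable (fun s => powKer ρ γ (t - s) • mlKer ρ α ‖S‖ β s) volume 0 t :=
    intervalIntegrable_of_integral_ne_zero (by
      rw [hI]; exact (mlKer_real_pos ρ hα (add_pos hβ hγ) (norm_nonneg S) ht).ne')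
  have hle : ∀ s, powKer ρ γ (t - s) * ‖mlKer ρ α S β s‖ ≤
      powKer ρ γ (t - s) • mlKer ρ α ‖S‖ β s := fun s =>
    mul_le_mul_of_nonneg_left (norm_mlKer_le h1 ρ hα hβ S s) (powKer_nonneg ρ hγ _)
  have hint' : IntervalIntegrable (fun s => powKer ρ γ (t - s) * ‖mlKer ρ α S β s‖) volume 0 t := by
    refine hint.mono_fun ?_ (Eventually.of_forall fun s => ?_)
    · exact (((measurable_powKer ρ γ).comp (measurable_const.sub measurable_id)).mul
        (stronglyMeasurable_mlKer h1 ρ hα hβ S).norm.measurable).aestronglyMeasurable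
    · have h0 := mul_nonneg (powKer_nonneg ρ hγ (t - s)) (norm_nonneg (mlKer ρ α S β s))
      beta_reduce
      rw [Real.norm_of_nonneg h0, Real.norm_of_nonneg (h0.trans (hle s))]
      exact hle s
  exact ⟨hint', hI ▸ integral_mono_on ht.le hint' hint fun s _ => hle s⟩

lemma intervalIntegrable_mlKer (h1 : ‖(1 : 𝔸)‖ ≤ 1) (ρ : ℝ) (hα : 0 < α) (hβ : 0 < β) (S : 𝔸)
    {T : ℝ} (hT : 0 < T) : IntervalIntegrable (mlKer ρ α S β) volume 0 T := by
  -- With `γ = 1` the power kernel is just `e^{-ρ(T-s)}`, which can be divided out.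
  have h := (powKer_smul_norm_mlKer h1 ρ hα hβ one_pos S hT).1
  have h2 : IntervalIntegrable (fun s => Real.exp (ρ * (T - s)) *
      (powKer ρ 1 (T - s) * ‖mlKer ρ α S β s‖)) volume 0 T :=
    h.continuousOn_mul (by fun_prop)
  refine h2.mono_fun (stronglyMeasurable_mlKer h1 ρ hα hβ S).aestronglyMeasurable ?_
  filter_upwards [ae_restrict_mem measurableSet_uIoc,
    ae_restrict_of_ae (by simp [ae_iff] : ∀ᵐ x : ℝ, x ≠ T)] with s hs hsT
  rw [uIoc_of_le hT.le] at hs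
  rw [powKer_one ρ (sub_pos.2 (lt_of_le_of_ne hs.2 hsT)), ← mul_assoc, ← Real.exp_add]
  simp

end NormedAlgebra

end

/-! ### Convolution with operator-valued kernels. -/

section

lemma ae_mem_Ioo_restrict (t : ℝ) : ∀ᵐ s ∂(volume.restrict (Ioc (0 : ℝ) t)), s ∈ Ioo 0 t := by
  filter_upwards [ae_restrict_mem measurableSet_Ioc,
    ae_restrict_of_ae (by simp [ae_iff] : ∀ᵐ x : ℝ, x ≠ t)] with s hs hst
  exact ⟨hs.1, lt_of_le_of_ne hs.2 hst⟩

section Shift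

variable {E : Type*} [NormedAddCommGroup E] {G : ℝ → E} {r t : ℝ}

/-- Because kernels vanish on `x ≤ 0`, integrals over the triangle `r < s` become integrals over the
square `(0,t]²`, where Fubini is applied. -/
lemma integrableOn_comp_sub_of_zero (hG : ∀ x ≤ 0, G x = 0) (hr : 0 ≤ r) (hrt : r ≤ t)
    (hint : IntervalIntegrable G volume 0 (t - r)) :
    IntegrableOn (fun s => G (s - r)) (Ioc 0 t) := by
  have h1 : IntervalIntegrable (fun s => G (s - r)) volume 0 r :=
    (IntervalIntegrable.zero (E := E)).congr fun s hs => by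
      rw [uIoc_of_le hr] at hs
      exact (hG _ (sub_nonpos.2 hs.2)).symm
  have h2 := hint.comp_sub_right r
  rw [zero_add, sub_add_cancel] at h2
  exact (intervalIntegrable_iff_integrableOn_Ioc_of_le (hr.trans hrt)).1 (h1.trans h2)

lemma setIntegral_comp_sub_of_zero [NormedSpace ℝ E] (hG : ∀ x ≤ 0, G x = 0) (hr : 0 ≤ r)
    (hrt : r ≤ t) : ∫ s in Ioc 0 t, G (s - r) = ∫ s in (0 : ℝ)..(t - r), G s := by
  have h2 := integral_comp_sub_right (a := r) (b := t) G r
  rw [sub_self] at h2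
  rw [← h2, integral_of_le hrt]
  refine setIntegral_eq_of_subset_of_forall_sdiff_eq_zero measurableSet_Ioc
    (Ioc_subset_Ioc_left hr) fun s hs => hG _ ?_
  by_contra h
  exact hs.2 ⟨by linarith, hs.1.2⟩

end Shift

variable {V : Type*} [NormedAddCommGroup V] [NormedSpace ℝ V]

/-- The convolution `∫₀ᵗ K(t-s) f(s) ds` of an operator-valued kernel and a function. -/
noncomputable def conv (K : ℝ → V →L[ℝ] V) (f : ℝ → V) (t : ℝ) : V :=
  ∫ s in (0 : ℝ)..t, K (t - s) (f s)

/-- The integral defining `conv K f t` converges absolutely. -/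
def ConvAt (K : ℝ → V →L[ℝ] V) (f : ℝ → V) (t : ℝ) : Prop :=
  IntervalIntegrable (fun s => K (t - s) (f s)) volume 0 t

/-- `K₃ = K₁ * K₂` on `(0,T]`, with a bounded absolute convolution. -/
structure IsKernelConv (T : ℝ) (K₁ K₂ K₃ : ℝ → V →L[ℝ] V) : Prop where
  measurable_left : StronglyMeasurable K₁
  measurable_right : StronglyMeasurable K₂
  zero_left : ∀ x ≤ 0, K₁ x = 0
  zero_right : ∀ x ≤ 0, K₂ x = 0
  integrable_left : IntervalIntegrable K₁ volume 0 T
  integrable_right : IntervalIntegrable K₂ volume 0 T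
  bound : ∃ C, ∀ x ∈ Ioc 0 T, IntervalIntegrable (fun s => ‖K₁ (x - s)‖ * ‖K₂ s‖) volume 0 x ∧
    ∫ s in (0 : ℝ)..x, ‖K₁ (x - s)‖ * ‖K₂ s‖ ≤ C
  integral_eq : ∀ x ∈ Ioc 0 T, ∫ s in (0 : ℝ)..x, K₁ (x - s) * K₂ s = K₃ x

/-- Tonelli, integrating in `s` first: the bound `C` is uniform in `r`, so integrability of `f`
alone suffices. It is used with `M s = K₁ (t - s)` for associativity and with `M = 1` for Young's
inequality. -/
lemma integrable_prod_kernel {M K : ℝ → V →L[ℝ] V} {f : ℝ → V} {t C : ℝ}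
    (hM : StronglyMeasurable M) (hK : StronglyMeasurable K)
    (hf : Integrable f (volume.restrict (Ioc 0 t)))
    (hint : ∀ r ∈ Ioo 0 t, IntegrableOn (fun s => ‖M s‖ * ‖K (s - r)‖) (Ioc 0 t))
    (hC : ∀ r ∈ Ioo 0 t, ∫ s in Ioc 0 t, ‖M s‖ * ‖K (s - r)‖ ≤ C) :
    Integrable (fun p : ℝ × ℝ => M p.1 (K (p.1 - p.2) (f p.2)))
      ((volume.restrict (Ioc 0 t)).prod (volume.restrict (Ioc 0 t))) := by
  have happ : ∀ {Ω : Type} [MeasurableSpace Ω] {ν : Measure Ω} {L : Ω → V →L[ℝ] V} {g : Ω → V},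
      AEStronglyMeasurable L ν → AEStronglyMeasurable g ν →
      AEStronglyMeasurable (fun x => L x (g x)) ν := fun hL hg =>
    (ContinuousLinearMap.id ℝ (V →L[ℝ] V)).aestronglyMeasurable_comp₂ hL hg
  have hmeas : AEStronglyMeasurable (fun p : ℝ × ℝ => M p.1 (K (p.1 - p.2) (f p.2)))
      ((volume.restrict (Ioc 0 t)).prod (volume.restrict (Ioc 0 t))) :=
    happ (hM.comp_measurable measurable_fst).aestronglyMeasurable
      (happ (hK.comp_measurable (measurable_fst.sub measurable_snd)).aestronglyMeasurable
        hf.aestronglyMeasurable.comp_snd)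
  have hle : ∀ s r, ‖M s (K (s - r) (f r))‖ ≤ ‖M s‖ * ‖K (s - r)‖ * ‖f r‖ := fun s r => by
    rw [mul_assoc]
    exact (M s).le_of_opNorm_le_of_le le_rfl ((K (s - r)).le_opNorm (f r))
  have hI : ∀ r ∈ Ioo 0 t, Integrable (fun s => M s (K (s - r) (f r)))
      (volume.restrict (Ioc 0 t)) := fun r hr =>
    ((hint r hr).mul_const ‖f r‖).mono'
      (happ hM.aestronglyMeasurable (happ (hK.comp_measurable
        (measurable_id.sub_const r)).aestronglyMeasurable aestronglyMeasurable_const))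
      (Eventually.of_forall fun s => hle s r)
  rw [integrable_prod_iff' hmeas]
  refine ⟨?_, ?_⟩
  · filter_upwards [ae_mem_Ioo_restrict t] with r hr using hI r hr
  · refine (hf.norm.const_mul C).mono' hmeas.norm.prod_swap.integral_prod_right' ?_
    filter_upwards [ae_mem_Ioo_restrict t] with r hr
    rw [Real.norm_of_nonneg (integral_nonneg fun _ => norm_nonneg _)]
    calc ∫ s in Ioc 0 t, ‖M s (K (s - r) (f r))‖
        ≤ ∫ s in Ioc 0 t, ‖M s‖ * ‖K (s - r)‖ * ‖f r‖ :=
          integral_mono (hI r hr).norm ((hint r hr).mul_const _) fun s => hle s r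
      _ = (∫ s in Ioc 0 t, ‖M s‖ * ‖K (s - r)‖) * ‖f r‖ := MeasureTheory.integral_mul_const _ _
      _ ≤ C * ‖f r‖ := mul_le_mul_of_nonneg_right (hC r hr) (norm_nonneg _)

lemma integrable_prod_kernel_one {K : ℝ → V →L[ℝ] V} {f : ℝ → V} {t : ℝ}
    (hK : StronglyMeasurable K) (hK0 : ∀ x ≤ 0, K x = 0) (hKint : IntervalIntegrable K volume 0 t)
    (hf : Integrable f (volume.restrict (Ioc 0 t))) :
    Integrable (fun p : ℝ × ℝ => K (p.1 - p.2) (f p.2))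
      ((volume.restrict (Ioc 0 t)).prod (volume.restrict (Ioc 0 t))) := by
  have hG0 : ∀ x ≤ 0, ‖(1 : V →L[ℝ] V)‖ * ‖K x‖ = 0 := fun x hx => by simp [hK0 x hx]
  have hG : IntervalIntegrable (fun x => ‖(1 : V →L[ℝ] V)‖ * ‖K x‖) volume 0 t :=
    hKint.norm.const_mul _
  refine integrable_prod_kernel (M := fun _ => 1)
    (C := ∫ s in (0 : ℝ)..t, ‖(1 : V →L[ℝ] V)‖ * ‖K s‖) stronglyMeasurable_const hK hf
    (fun r hr => ?_) (fun r hr => ?_)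
  · refine integrableOn_comp_sub_of_zero (G := fun x => ‖(1 : V →L[ℝ] V)‖ * ‖K x‖)
      hG0 hr.1.le hr.2.le (hG.mono_set ?_)
    exact uIcc_subset_uIcc_left (by rw [uIcc_of_le (by linarith [hr.1, hr.2])]; constructor <;> linarith [hr.1, hr.2])
  · rw [setIntegral_comp_sub_of_zero (G := fun x => ‖(1 : V →L[ℝ] V)‖ * ‖K x‖)
      hG0 hr.1.le hr.2.le]
    exact integral_mono_interval le_rfl (by linarith [hr.2]) (by linarith [hr.1])
      (Eventually.of_forall fun s => by positivity) hG

lemma setIntegral_kernel_eq_conv {K : ℝ → V →L[ℝ] V} (hK0 : ∀ x ≤ 0, K x = 0) (f : ℝ → V)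
    {s t : ℝ} (hs : 0 ≤ s) (hst : s ≤ t) :
    ∫ r in Ioc 0 t, K (s - r) (f r) = conv K f s := by
  rw [conv, integral_of_le hs]
  refine (setIntegral_eq_of_subset_of_forall_sdiff_eq_zero measurableSet_Ioc
    (Ioc_subset_Ioc_right hst) fun r hr => ?_)
  have : s - r ≤ 0 := by
    by_contra h
    exact hr.2 ⟨hr.1.1, by linarith⟩
  simp [hK0 _ this]

lemma intervalIntegrable_conv {K : ℝ → V →L[ℝ] V} {f : ℝ → V} {T : ℝ} (hT : 0 ≤ T)
    (hK : StronglyMeasurable K) (hK0 : ∀ x ≤ 0, K x = 0) (hKint : IntervalIntegrable K volume 0 T)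
    (hf : IntervalIntegrable f volume 0 T) :
    IntervalIntegrable (conv K f) volume 0 T ∧ ∀ᵐ t : ℝ, t ∈ Ioc 0 T → ConvAt K f t := by
  have h := integrable_prod_kernel_one hK hK0 hKint
    ((intervalIntegrable_iff_integrableOn_Ioc_of_le hT).1 hf)
  constructor
  · rw [intervalIntegrable_iff_integrableOn_Ioc_of_le hT]
    refine h.integral_prod_left.congr ?_
    filter_upwards [ae_restrict_mem measurableSet_Ioc] with s hs
    exact setIntegral_kernel_eq_conv hK0 f hs.1.le hs.2
  · rw [← ae_restrict_iff' measurableSet_Ioc]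
    filter_upwards [h.prod_right_ae, ae_restrict_mem measurableSet_Ioc] with s hs hsT
    rw [ConvAt, intervalIntegrable_iff_integrableOn_Ioc_of_le hsT.1.le]
    exact IntegrableOn.mono_set hs (Ioc_subset_Ioc_right hsT.2)

/-- The substitution `s ↦ x - s` reverses the order of the factors. -/
lemma IsKernelConv.swap {T : ℝ} {K₁ K₂ K₃ : ℝ → V →L[ℝ] V} (h : IsKernelConv T K₁ K₂ K₃)
    (hcomm : ∀ x y, K₁ x * K₂ y = K₂ y * K₁ x) : IsKernelConv T K₂ K₁ K₃ := by
  obtain ⟨C, hC⟩ := h.bound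
  refine ⟨h.measurable_right, h.measurable_left, h.zero_right, h.zero_left, h.integrable_right,
    h.integrable_left, ⟨C, fun x hx => ⟨?_, ?_⟩⟩, fun x hx => ?_⟩
  · have := (hC x hx).1.comp_sub_left x
    simp only [sub_sub_cancel, sub_zero, sub_self] at this
    simpa only [mul_comm] using this.symm
  · have := integral_comp_sub_left (a := 0) (b := x) (fun s => ‖K₁ (x - s)‖ * ‖K₂ s‖) x
    simp only [sub_sub_cancel, sub_zero, sub_self] at this
    simp only [mul_comm ‖K₂ _‖]
    exact this.trans_le (hC x hx).2
  · have := integral_comp_sub_left (a := 0) (b := x) (fun s => K₁ (x - s) * K₂ s) x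
    simp only [sub_sub_cancel, sub_zero, sub_self] at this
    simp only [← hcomm]
    rw [this, h.integral_eq x hx]

/-- The scalar power kernel as an operator-valued kernel. -/
noncomputable def powOp (V : Type*) [NormedAddCommGroup V] [NormedSpace ℝ V] (ρ β x : ℝ) :
    V →L[ℝ] V :=
  powKer ρ β x • (1 : V →L[ℝ] V)

lemma powOp_apply (ρ β x : ℝ) (v : V) : powOp V ρ β x v = powKer ρ β x • v := rfl

lemma norm_one_clm_le : ‖(1 : V →L[ℝ] V)‖ ≤ 1 := ContinuousLinearMap.norm_id_le

lemma norm_powOp_le (ρ : ℝ) {β : ℝ} (hβ : 0 < β) (x : ℝ) : ‖powOp V ρ β x‖ ≤ powKer ρ β x := by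
  rw [powOp, norm_smul, Real.norm_of_nonneg (powKer_nonneg ρ hβ x)]
  exact mul_le_of_le_one_right (powKer_nonneg ρ hβ x) norm_one_clm_le

lemma stronglyMeasurable_powOp (ρ β : ℝ) : StronglyMeasurable (powOp V ρ β) :=
  (measurable_powKer ρ β).stronglyMeasurable.smul stronglyMeasurable_const

variable [CompleteSpace V]

/-- Associativity of convolution, at every time. -/
lemma IsKernelConv.conv_conv {T : ℝ} {K₁ K₂ K₃ : ℝ → V →L[ℝ] V} (h : IsKernelConv T K₁ K₂ K₃)
    {f : ℝ → V} (hf : IntervalIntegrable f volume 0 T) {t : ℝ} (ht : t ∈ Ioc 0 T) :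
    ConvAt K₁ (conv K₂ f) t ∧ ConvAt K₃ f t ∧ conv K₁ (conv K₂ f) t = conv K₃ f t := by
  obtain ⟨C, hC⟩ := h.bound
  have hsub : uIcc 0 t ⊆ uIcc 0 T := by
    rw [uIcc_of_le ht.1.le, uIcc_of_le (ht.1.le.trans ht.2)]; exact Icc_subset_Icc_right ht.2
  have hft := (intervalIntegrable_iff_integrableOn_Ioc_of_le ht.1.le).1 (hf.mono_set hsub)
  have hxr : ∀ {r}, r ∈ Ioo 0 t → t - r ∈ Ioc 0 T := fun hr =>
    ⟨by linarith [hr.2], by linarith [hr.1, ht.2]⟩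
  have hsubst : ∀ r s : ℝ, t - r - (s - r) = t - s := fun r s => by ring
  have hprod := integrable_prod_kernel (M := fun s => K₁ (t - s)) (C := C)
    (h.measurable_left.comp_measurable (measurable_const.sub measurable_id)) h.measurable_right hft
    (fun r hr => by
      simpa only [hsubst] using integrableOn_comp_sub_of_zero
        (G := fun x => ‖K₁ (t - r - x)‖ * ‖K₂ x‖) (fun x hx => by simp [h.zero_right x hx])
        hr.1.le hr.2.le (hC _ (hxr hr)).1)
    (fun r hr => by
      have e := setIntegral_comp_sub_of_zero
        (G := fun x => ‖K₁ (t - r - x)‖ * ‖K₂ x‖) (fun x hx => by simp [h.zero_right x hx])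
        hr.1.le hr.2.le
      simp only [hsubst] at e
      exact e.trans_le (hC _ (hxr hr)).2)
  have hone := integrable_prod_kernel_one h.measurable_right h.zero_right
    (h.integrable_right.mono_set hsub) hft
  -- The two iterated integrals of the double integrand are `K₁ * (K₂ * f)` and `(K₁ * K₂) * f`;
  -- Fubini equates them.
  have hleft : ∀ᵐ s ∂(volume.restrict (Ioc 0 t)),
      ∫ r in Ioc 0 t, K₁ (t - s) (K₂ (s - r) (f r)) = K₁ (t - s) (conv K₂ f s) := by
    filter_upwards [hone.prod_right_ae, ae_restrict_mem measurableSet_Ioc] with s hs hst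
    rw [(K₁ (t - s)).integral_comp_comm hs, setIntegral_kernel_eq_conv h.zero_right f hst.1.le hst.2]
  have hright : ∀ᵐ r ∂(volume.restrict (Ioc 0 t)),
      ∫ s in Ioc 0 t, K₁ (t - s) (K₂ (s - r) (f r)) = K₃ (t - r) (f r) := by
    filter_upwards [ae_mem_Ioo_restrict t] with r hr
    have hz : ∀ x ≤ 0, K₁ (t - r - x) * K₂ x = 0 := fun x hx => by simp [h.zero_right x hx]
    have hmeas : AEStronglyMeasurable (fun x => K₁ (t - r - x) * K₂ x)
        (volume.restrict (uIoc 0 (t - r))) :=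
      ((h.measurable_left.comp_measurable (measurable_const.sub measurable_id)).mul
        h.measurable_right).aestronglyMeasurable
    have hint : IntervalIntegrable (fun x => K₁ (t - r - x) * K₂ x) volume 0 (t - r) :=
      (hC _ (hxr hr)).1.mono_fun hmeas (Eventually.of_forall fun s => by
        beta_reduce
        rw [Real.norm_of_nonneg (by positivity)]
        exact norm_mul_le _ _)
    have hon := integrableOn_comp_sub_of_zero hz hr.1.le hr.2.le hint
    have e := setIntegral_comp_sub_of_zero hz hr.1.le hr.2.le
    simp only [hsubst] at e hon
    rw [← h.integral_eq _ (hxr hr), ← e, ContinuousLinearMap.integral_apply hon]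
    rfl
  refine ⟨?_, ?_, ?_⟩
  · rw [ConvAt, intervalIntegrable_iff_integrableOn_Ioc_of_le ht.1.le]
    exact hprod.integral_prod_left.congr hleft
  · rw [ConvAt, intervalIntegrable_iff_integrableOn_Ioc_of_le ht.1.le]
    exact hprod.integral_prod_right.congr hright
  · rw [conv, conv, integral_of_le ht.1.le, integral_of_le ht.1.le, ← integral_congr_ae hleft,
      ← integral_congr_ae hright]
    exact integral_integral_swap hprod

lemma intervalIntegrable_powOp (ρ : ℝ) {β T : ℝ} (hβ : 0 < β) (hT : 0 < T) :
    IntervalIntegrable (powOp V ρ β) volume 0 T := by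
  -- The power kernel is the Mittag-Leffler kernel with `S = 0`.
  refine (intervalIntegrable_mlKer (norm_one_clm_le (V := V)) ρ one_pos hβ 0 hT).congr
    fun x _ => ?_
  rw [mlKer_eq_add norm_one_clm_le ρ one_pos hβ, zero_mul, add_zero]
  rfl

lemma isKernelConv_powOp_mlKer {ρ α β γ T : ℝ} (hρ : 0 ≤ ρ) (hα : 0 < α) (hβ : 0 < β)
    (hγ : 0 < γ) (hβγ : 1 ≤ β + γ) (hT : 0 < T) (S : V →L[ℝ] V) :
    IsKernelConv T (powOp V ρ γ) (mlKer ρ α S β) (mlKer ρ α S (β + γ)) where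
  measurable_left := stronglyMeasurable_powOp ρ γ
  measurable_right := stronglyMeasurable_mlKer norm_one_clm_le ρ hα hβ S
  zero_left x hx := by rw [powOp, powKer_of_nonpos _ _ hx, zero_smul]
  zero_right x hx := mlKer_of_nonpos ρ α S β hx
  integrable_left := intervalIntegrable_powOp ρ hγ hT
  integrable_right := intervalIntegrable_mlKer norm_one_clm_le ρ hα hβ S hT
  bound := by
    -- Since `β + γ ≥ 1` and `ρ ≥ 0`, the dominating scalar kernel on `(0,T]` is at most its
    -- untempered value at `T`.
    refine ⟨mlKer 0 α ‖S‖ (β + γ) T, fun x hx => ?_⟩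
    obtain ⟨h1, h2⟩ := powKer_smul_norm_mlKer norm_one_clm_le ρ hα hβ hγ S hx.1
    have hle : ∀ s, ‖powOp V ρ γ (x - s)‖ * ‖mlKer ρ α S β s‖ ≤
        powKer ρ γ (x - s) * ‖mlKer ρ α S β s‖ := fun s =>
      mul_le_mul_of_nonneg_right (norm_powOp_le ρ hγ _) (norm_nonneg _)
    have hint : IntervalIntegrable (fun s => ‖powOp V ρ γ (x - s)‖ * ‖mlKer ρ α S β s‖)
        volume 0 x := by
      refine h1.mono_fun ?_ (Eventually.of_forall fun s => ?_)
      · exact (((stronglyMeasurable_powOp ρ γ).comp_measurable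
          (measurable_const.sub measurable_id)).norm.mul
          (stronglyMeasurable_mlKer norm_one_clm_le ρ hα hβ S).norm).aestronglyMeasurable
      · beta_reduce
        rw [Real.norm_of_nonneg (by positivity)]
        exact (hle s).trans (le_abs_self _)
    exact ⟨hint, (integral_mono_on hx.1.le hint h1 fun s _ => hle s).trans
      (h2.trans (mlKer_real_le hρ hα hβγ (norm_nonneg S) hx.1 hx.2))⟩
  integral_eq x hx := by
    simpa only [powOp, smul_mul_assoc, one_mul] using
      integral_powKer_smul_mlKer norm_one_clm_le ρ hα hβ hγ S hx.1

lemma isKernelConv_mlKer_powOp {ρ α β γ T : ℝ} (hρ : 0 ≤ ρ) (hα : 0 < α) (hβ : 0 < β)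
    (hγ : 0 < γ) (hβγ : 1 ≤ β + γ) (hT : 0 < T) (S : V →L[ℝ] V) :
    IsKernelConv T (mlKer ρ α S β) (powOp V ρ γ) (mlKer ρ α S (β + γ)) :=
  (isKernelConv_powOp_mlKer hρ hα hβ hγ hβγ hT S).swap fun x y => by simp [powOp]

end

/-! ### Convolution identities for the equation. -/

section

variable {V : Type*} [NormedAddCommGroup V] [NormedSpace ℝ V]

lemma ae_eq_restrict_uIoc {E : Type*} {f g : ℝ → E} {t T : ℝ} (ht : t ∈ Ioc 0 T)
    (h : ∀ᵐ s : ℝ, s ∈ Ioc 0 T → f s = g s) : ∀ᵐ s : ℝ, s ∈ uIoc 0 t → f s = g s := by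
  filter_upwards [h] with s hs hst
  rw [uIoc_of_le ht.1.le] at hst
  exact hs ⟨hst.1, hst.2.trans ht.2⟩

section ConvAlgebra

variable {K L : ℝ → V →L[ℝ] V} {f g : ℝ → V} {t T : ℝ}

lemma ConvAt.congr_ae (ht : t ∈ Ioc 0 T) (hf : ConvAt K f t)
    (h : ∀ᵐ s : ℝ, s ∈ Ioc 0 T → f s = g s) : ConvAt K g t := by
  refine IntervalIntegrable.congr_ae hf ((ae_restrict_iff' measurableSet_uIoc).2 ?_)
  filter_upwards [ae_eq_restrict_uIoc ht h] with s hs hst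
  rw [hs hst]

lemma conv_congr_ae (K : ℝ → V →L[ℝ] V) (ht : t ∈ Ioc 0 T)
    (h : ∀ᵐ s : ℝ, s ∈ Ioc 0 T → f s = g s) : conv K f t = conv K g t := by
  refine integral_congr_ae ?_
  filter_upwards [ae_eq_restrict_uIoc ht h] with s hs hst
  rw [hs hst]

lemma ConvAt.add (hf : ConvAt K f t) (hg : ConvAt K g t) : ConvAt K (fun s => f s + g s) t := by
  simpa only [ConvAt, map_add] using IntervalIntegrable.add hf hg

lemma ConvAt.sub (hf : ConvAt K f t) (hg : ConvAt K g t) : ConvAt K (fun s => f s - g s) t := by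
  simpa only [ConvAt, map_sub] using IntervalIntegrable.sub hf hg

lemma conv_add (hf : ConvAt K f t) (hg : ConvAt K g t) :
    conv K (fun s => f s + g s) t = conv K f t + conv K g t := by
  simpa only [conv, map_add] using intervalIntegral.integral_add hf hg

lemma conv_sub (hf : ConvAt K f t) (hg : ConvAt K g t) :
    conv K (fun s => f s - g s) t = conv K f t - conv K g t := by
  simpa only [conv, map_sub] using intervalIntegral.integral_sub hf hg

lemma ConvAt.comp_commute {S : V →L[ℝ] V} (hS : ∀ x, S * K x = K x * S) (hf : ConvAt K f t) :
    ConvAt K (fun s => S (f s)) t := by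
  have h : IntervalIntegrable (fun s => S (K (t - s) (f s))) volume 0 t :=
    ⟨S.integrable_comp hf.1, S.integrable_comp hf.2⟩
  refine h.congr fun s _ => ?_
  exact DFunLike.congr_fun (hS (t - s)) (f s)

lemma conv_comp_commute [CompleteSpace V] {S : V →L[ℝ] V} (hS : ∀ x, S * K x = K x * S) (hf : ConvAt K f t) :
    conv K (fun s => S (f s)) t = S (conv K f t) := by
  rw [conv, conv, ← S.intervalIntegral_comp_comm hf]
  exact integral_congr fun s _ => (DFunLike.congr_fun (hS (t - s)) (f s)).symm

lemma conv_kernel_add_comp [CompleteSpace V] {K' : ℝ → V →L[ℝ] V} {S : V →L[ℝ] V} (hK : ∀ x, K' x = K x + S * L x)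
    (hf : ConvAt K f t) (hg : ConvAt L f t) : conv K' f t = conv K f t + S (conv L f t) := by
  have h : IntervalIntegrable (fun s => S (L (t - s) (f s))) volume 0 t :=
    ⟨S.integrable_comp hg.1, S.integrable_comp hg.2⟩
  rw [conv, conv, conv, ← S.intervalIntegral_comp_comm hg, ← intervalIntegral.integral_add hf h]
  exact integral_congr fun s _ => by simp [hK]

/-- Associativity with `f` replaced by a point mass `v` at `0`; it handles the terms coming from
initial values. -/
lemma IsKernelConv.convAt_apply {K₁ K₂ K₃ : ℝ → V →L[ℝ] V} (h : IsKernelConv T K₁ K₂ K₃)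
    (ht : t ∈ Ioc 0 T) (v : V) :
    ConvAt K₁ (fun s => K₂ s v) t ∧ conv K₁ (fun s => K₂ s v) t = K₃ t v := by
  obtain ⟨C, hC⟩ := h.bound
  have hint : IntervalIntegrable (fun x => K₁ (t - x) * K₂ x) volume 0 t :=
    (hC t ht).1.mono_fun ((h.measurable_left.comp_measurable
      (measurable_const.sub measurable_id)).mul h.measurable_right).aestronglyMeasurable
      (Eventually.of_forall fun s => by
        beta_reduce
        rw [Real.norm_of_nonneg (by positivity)]
        exact norm_mul_le _ _)
  refine ⟨⟨hint.1.apply_continuousLinearMap v, hint.2.apply_continuousLinearMap v⟩, ?_⟩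
  rw [← h.integral_eq t ht, ContinuousLinearMap.intervalIntegral_apply hint]
  rfl

end ConvAlgebra

variable {ρ α T t : ℝ}

lemma conv_powOp_one (f : ℝ → V) (ht : 0 ≤ t) :
    conv (powOp V ρ 1) f t = ∫ s in (0 : ℝ)..t, Real.exp (-ρ * (t - s)) • f s := by
  refine integral_congr_ae ?_
  filter_upwards [(by simp [ae_iff] : ∀ᵐ x : ℝ, x ≠ t)] with s hs hst
  rw [uIoc_of_le ht] at hst
  rw [powOp_apply, powKer_one ρ (sub_pos.2 (lt_of_le_of_ne hst.2 hs))]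

lemma convAt_powOp_one {f : ℝ → V} (hf : IntervalIntegrable f volume 0 T) (ht : t ∈ Ioc 0 T) :
    ConvAt (powOp V ρ 1) f t := by
  have hsub : uIcc 0 t ⊆ uIcc 0 T := by
    rw [uIcc_of_le ht.1.le, uIcc_of_le (ht.1.le.trans ht.2)]; exact Icc_subset_Icc_right ht.2
  have h : IntervalIntegrable (fun s => Real.exp (-ρ * (t - s)) • f s) volume 0 t :=
    (hf.mono_set hsub).continuousOn_smul (by fun_prop)
  refine h.congr_ae ((ae_restrict_iff' measurableSet_uIoc).2 ?_)
  filter_upwards [(by simp [ae_iff] : ∀ᵐ x : ℝ, x ≠ t)] with s hs hst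
  rw [uIoc_of_le ht.1.le] at hst
  rw [powOp_apply, powKer_one ρ (sub_pos.2 (lt_of_le_of_ne hst.2 hs))]

variable [CompleteSpace V]

lemma mlKer_one_eq (ρ : ℝ) (hα : 0 < α) (S : V →L[ℝ] V) (x : ℝ) :
    mlKer ρ α S 1 x = powOp V ρ 1 x + S * mlKer ρ α S (1 + α) x :=
  mlKer_eq_add norm_one_clm_le ρ hα one_pos S x

lemma isKernelConv_mlKer_one (hρ : 0 ≤ ρ) (hα : 0 < α) (hα1 : α < 1) (hT : 0 < T)
    (S : V →L[ℝ] V) :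
    IsKernelConv T (mlKer ρ α S α) (powOp V ρ (1 - α)) (mlKer ρ α S 1) ∧
    IsKernelConv T (powOp V ρ (1 - α)) (mlKer ρ α S α) (mlKer ρ α S 1) := by
  have h1 := isKernelConv_mlKer_powOp hρ hα hα (γ := 1 - α) (by linarith) (by linarith) hT S
  have h2 := isKernelConv_powOp_mlKer hρ hα hα (γ := 1 - α) (by linarith) (by linarith) hT S
  rw [add_sub_cancel] at h1 h2
  exact ⟨h1, h2⟩

lemma isKernelConv_mlKer_one_add (hρ : 0 ≤ ρ) (hα : 0 < α) (hT : 0 < T) (S : V →L[ℝ] V) :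
    IsKernelConv T (mlKer ρ α S α) (powOp V ρ 1) (mlKer ρ α S (1 + α)) ∧
    IsKernelConv T (powOp V ρ 1) (mlKer ρ α S α) (mlKer ρ α S (1 + α)) := by
  have h1 := isKernelConv_mlKer_powOp hρ hα hα one_pos (by linarith) hT S
  have h2 := isKernelConv_powOp_mlKer hρ hα hα one_pos (by linarith) hT S
  rw [add_comm α 1] at h1 h2
  exact ⟨h1, h2⟩

lemma conv_mlKer_one (hρ : 0 ≤ ρ) (hα : 0 < α) (S : V →L[ℝ] V) {f : ℝ → V}
    (hf : IntervalIntegrable f volume 0 T) (ht : t ∈ Ioc 0 T) :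
    conv (mlKer ρ α S 1) f t = conv (powOp V ρ 1) f t + S (conv (mlKer ρ α S (1 + α)) f t) :=
  conv_kernel_add_comp (mlKer_one_eq ρ hα S) (convAt_powOp_one hf ht)
    ((isKernelConv_mlKer_one_add hρ hα (ht.1.trans_le ht.2) S).1.conv_conv hf ht).2.1

/-- Convolving the Caputo derivative of `y` with the Mittag-Leffler kernel recovers `y`. -/
lemma conv_mlKer_conv_powOp (hρ : 0 ≤ ρ) (hα : 0 < α) (hα1 : α < 1) (S : V →L[ℝ] V)
    {f y : ℝ → V} {y₀ : V} (hf : IntervalIntegrable f volume 0 T)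
    (hy : ∀ t ∈ Ioc 0 T, y t = powOp V ρ 1 t y₀ + conv (powOp V ρ 1) f t) (ht : t ∈ Ioc 0 T) :
    ConvAt (mlKer ρ α S α) (conv (powOp V ρ (1 - α)) f) t ∧
    ConvAt (mlKer ρ α S α) (fun s => S (y s)) t ∧
    conv (mlKer ρ α S α) (conv (powOp V ρ (1 - α)) f) t
      = y t - mlKer ρ α S 1 t y₀ + conv (mlKer ρ α S α) (fun s => S (y s)) t := by
  have hT := ht.1.trans_le ht.2
  have hcomm := commute_mlKer (norm_one_clm_le (V := V)) ρ hα hα S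
  obtain ⟨a1, -, a3⟩ := (isKernelConv_mlKer_one hρ hα hα1 hT S).1.conv_conv hf ht
  have hK := (isKernelConv_mlKer_one_add hρ hα hT S).1
  obtain ⟨b1, -, b3⟩ := hK.conv_conv hf ht
  obtain ⟨c1, c2⟩ := hK.convAt_apply ht y₀
  have hy' : ∀ᵐ s : ℝ, s ∈ Ioc 0 T → powOp V ρ 1 s y₀ + conv (powOp V ρ 1) f s = y s :=
    Eventually.of_forall fun s hs => (hy s hs).symm
  have hky : ConvAt (mlKer ρ α S α) y t := (c1.add b1).congr_ae ht hy'
  refine ⟨a1, hky.comp_commute hcomm, ?_⟩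
  -- Uses `E_α * k_{1-α} = E_1`, `E_α * k_1 = E_{1+α}` and `E_1 = k_1 + S E_{1+α}`.
  rw [conv_comp_commute hcomm hky, ← conv_congr_ae _ ht hy', conv_add c1 b1, a3, b3, c2,
    conv_mlKer_one hρ hα S hf ht, hy t ht, mlKer_one_eq ρ hα S t]
  simp only [_root_.add_apply, mul_apply_eq_comp, map_add]
  abel

/-- Convolution with the Mittag-Leffler kernel is injective. -/
lemma ae_eq_zero_of_conv_mlKer_eq_zero (hρ : 0 ≤ ρ) (hα : 0 < α) (hα1 : α < 1) (hT : 0 < T)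
    (S : V →L[ℝ] V) {r : ℝ → V} (hr : IntervalIntegrable r volume 0 T)
    (h : ∀ t ∈ Ioc 0 T, conv (mlKer ρ α S α) r t = 0) : ∀ᵐ t : ℝ, t ∈ Ioc 0 T → r t = 0 := by
  have hz : ∀ K : ℝ → V →L[ℝ] V, ∀ t ∈ Ioc 0 T, conv K (conv (mlKer ρ α S α) r) t = 0 :=
    fun K t ht => by
      rw [conv_congr_ae (g := fun _ => 0) K ht (Eventually.of_forall h)]
      simp [conv]
  have key : ∀ t ∈ Ioc 0 T, ∫ s in (0 : ℝ)..t, Real.exp (ρ * s) • r s = 0 := fun t ht => by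
    -- Convolving the hypothesis with `k_{1-α}` and `k_1` gives `E_1 * r = 0` and `E_{1+α} * r = 0`,
    -- so `k_1 * r = 0`.
    have h1 := ((isKernelConv_mlKer_one hρ hα hα1 hT S).2.conv_conv hr ht).2.2
    have h2 := ((isKernelConv_mlKer_one_add hρ hα hT S).2.conv_conv hr ht).2.2
    rw [hz _ t ht] at h1 h2
    rw [conv_mlKer_one hρ hα S hr ht, ← h2, map_zero, add_zero, conv_powOp_one r ht.1.le,
      exp_smul_integral] at h1
    exact (smul_eq_zero.1 h1.symm).resolve_left (Real.exp_ne_zero _)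
  filter_upwards [ae_eq_zero_of_forall_integral_eq_zero hT.le (intervalIntegrable_exp_smul ρ hr) key]
    with t ht htT
  exact (smul_eq_zero.1 (ht htT)).resolve_left (Real.exp_ne_zero _)

lemma intervalIntegrable_mlKer_apply_add_conv (ρ : ℝ) (hα : 0 < α) (hT : 0 < T) (S : V →L[ℝ] V)
    {φ : ℝ → V} (hφ : IntervalIntegrable φ volume 0 T) (c : V) :
    IntervalIntegrable (fun s => mlKer ρ α S α s c + conv (mlKer ρ α S α) φ s) volume 0 T := by
  have hk := intervalIntegrable_mlKer (norm_one_clm_le (V := V)) ρ hα hα S hT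
  refine IntervalIntegrable.add
    ⟨hk.1.apply_continuousLinearMap c, hk.2.apply_continuousLinearMap c⟩ ?_
  exact (intervalIntegrable_conv hT.le (stronglyMeasurable_mlKer norm_one_clm_le ρ hα hα S)
    (fun x hx => mlKer_of_nonpos ρ α S α hx) hk hφ).1

/-- The variation of constants formula with an absolutely continuous forcing term. -/
lemma conv_mlKer_of_eq_conv_powOp (hρ : 0 ≤ ρ) (hα : 0 < α) (hα1 : α < 1) (S : V →L[ℝ] V)
    {φ g : ℝ → V} {y₀ g₀ : V} (hφ : IntervalIntegrable φ volume 0 T)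
    (hg : ∀ t ∈ Ioc 0 T, g t = powOp V ρ 1 t g₀ + conv (powOp V ρ 1) φ t) {F : ℝ → V}
    (hF : F = fun s => mlKer ρ α S α s (S y₀ + g₀) + conv (mlKer ρ α S α) φ s)
    (ht : t ∈ Ioc 0 T) :
    mlKer ρ α S 1 t y₀ + conv (mlKer ρ α S α) g t
      = powOp V ρ 1 t y₀ + conv (powOp V ρ 1) F t ∧
    ConvAt (powOp V ρ (1 - α)) F t ∧ conv (powOp V ρ (1 - α)) F t
      = S (mlKer ρ α S 1 t y₀ + conv (mlKer ρ α S α) g t) + g t := by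
  have hT := ht.1.trans_le ht.2
  have hE := (isKernelConv_mlKer_one hρ hα hα1 hT S).2
  obtain ⟨hK, hK'⟩ := isKernelConv_mlKer_one_add hρ hα hT S
  obtain ⟨a1, -, a3⟩ := hE.conv_conv hφ ht
  obtain ⟨a4, a5⟩ := hE.convAt_apply ht (S y₀ + g₀)
  obtain ⟨b1, -, b3⟩ := hK.conv_conv hφ ht
  obtain ⟨b4, b5⟩ := hK.convAt_apply ht g₀
  obtain ⟨c1, -, c3⟩ := hK'.conv_conv hφ ht
  obtain ⟨c4, c5⟩ := hK'.convAt_apply ht (S y₀ + g₀)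
  have hg' : ∀ᵐ s : ℝ, s ∈ Ioc 0 T → g s = powOp V ρ 1 s g₀ + conv (powOp V ρ 1) φ s :=
    Eventually.of_forall fun s hs => hg s hs
  have hcomm := DFunLike.congr_fun
    (commute_mlKer (norm_one_clm_le (V := V)) ρ hα (by linarith : 0 < 1 + α) S t) y₀
  simp only [mul_apply_eq_comp] at hcomm
  have hkg : conv (mlKer ρ α S α) g t
      = mlKer ρ α S (1 + α) t g₀ + conv (mlKer ρ α S (1 + α)) φ t := by
    rw [conv_congr_ae _ ht hg', conv_add b4 b1, b5, b3]
  subst hF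
  refine ⟨?_, a4.add a1, ?_⟩
  · rw [conv_add c4 c1, c5, c3, hkg, mlKer_one_eq ρ hα S t]
    simp only [_root_.add_apply, mul_apply_eq_comp, map_add, hcomm]
    abel
  · rw [conv_add a4 a1, a5, a3, hkg, hg t ht, conv_mlKer_one hρ hα S hφ ht, mlKer_one_eq ρ hα S t]
    simp only [_root_.add_apply, mul_apply_eq_comp, map_add, hcomm]
    rw [powOp_apply, powOp_apply, powOp_apply, map_smul]
    abel

end

/-! ### Return to matrices and the two parts of the theorem. -/

section

/-- A matrix as a continuous linear map on `Fin n → ℝ`. -/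
noncomputable def matCLM {n m : ℕ} (A : Matrix (Fin n) (Fin m) ℝ) : (Fin m → ℝ) →L[ℝ] (Fin n → ℝ) :=
  LinearMap.toContinuousLinearMap (Matrix.toLin' A)

lemma matCLM_apply {n m : ℕ} (A : Matrix (Fin n) (Fin m) ℝ) (v : Fin m → ℝ) :
    matCLM A v = A *ᵥ v := Matrix.toLin'_apply A v

/-- The matrix of a continuous linear map, as a continuous linear map. -/
noncomputable def clmToMatrix (n : ℕ) :
    ((Fin n → ℝ) →L[ℝ] (Fin n → ℝ)) →L[ℝ] Matrix (Fin n) (Fin n) ℝ :=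
  ⟨LinearMap.toMatrix'.toLinearMap ∘ₗ ContinuousLinearMap.coeLM ℝ,
    LinearMap.continuous_of_finiteDimensional _⟩

lemma clmToMatrix_mulVec {n : ℕ} (L : (Fin n → ℝ) →L[ℝ] (Fin n → ℝ)) (v : Fin n → ℝ) :
    clmToMatrix n L *ᵥ v = L v := LinearMap.toMatrix'_mulVec _ v

lemma clmToMatrix_matCLM_pow {n : ℕ} (A : Matrix (Fin n) (Fin n) ℝ) (l : ℕ) :
    clmToMatrix n (matCLM A ^ l) = A ^ l := by
  refine Matrix.ext_of_mulVec_single fun i => ?_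
  rw [clmToMatrix_mulVec]
  generalize (Pi.single i 1 : Fin n → ℝ) = v
  induction l generalizing v with
  | zero => simp
  | succ l ih => rw [pow_succ, pow_succ, mul_apply_eq_comp, ih, matCLM_apply, mulVec_mulVec]

variable {n m : ℕ} {α ρ T : ℝ}

/-- The factor `x^{αl}` of the `l`-th term is absorbed into `(x^α A)^l`; the continuous linear map
`clmToMatrix` carries the operator series to the matrix series. -/
lemma mlKer_matCLM_apply (ρ : ℝ) (hα : 0 < α) {β : ℝ} (hβ : 0 < β) (A : Matrix (Fin n) (Fin n) ℝ)
    {x : ℝ} (hx : 0 < x) (v : Fin n → ℝ) :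
    mlKer ρ α (matCLM A) β x v
      = (Real.exp (-ρ * x) * x ^ (β - 1)) • (mittagLeffler₂ α β (x ^ α • A) *ᵥ v) := by
  have h := (clmToMatrix n).hasSum
    (summable_powKer_smul_pow norm_one_clm_le ρ hα hβ (matCLM A) x).hasSum
  have e : ∀ l : ℕ, clmToMatrix n (powKer ρ (α * l + β) x • matCLM A ^ l)
      = (Real.exp (-ρ * x) * x ^ (β - 1)) •
        ((Real.Gamma (α * l + β))⁻¹ • (x ^ α • A) ^ l) := fun l => by
    rw [map_smul, clmToMatrix_matCLM_pow, powKer_of_pos _ _ hx, smul_pow, smul_smul, smul_smul,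
      show α * l + β - 1 = (β - 1) + α * l by ring, Real.rpow_add hx, Real.rpow_mul hx.le,
      Real.rpow_natCast]
    congr 1
    ring
  simp only [e] at h
  rw [← clmToMatrix_mulVec, ← smul_mulVec, mittagLeffler₂, ← tsum_const_smul'', h.tsum_eq]
  rfl

lemma mittagLeffler_zero {n : ℕ} (α : ℝ) :
    mittagLeffler α (0 : Matrix (Fin n) (Fin n) ℝ) = 1 := by
  rw [mittagLeffler, tsum_eq_single 0 fun l hl => by simp [zero_pow hl]]
  simp

lemma solutionFormula_zero (hα : 0 < α) (A : Matrix (Fin n) (Fin n) ℝ)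
    (B : Matrix (Fin n) (Fin m) ℝ) (u : ℝ → Fin m → ℝ) (y₀ : Fin n → ℝ) :
    solutionFormula α ρ A B u y₀ 0 = y₀ := by
  simp [solutionFormula, Real.zero_rpow hα.ne', mittagLeffler_zero]

lemma forcingIntegrand_eq (hα : 0 < α) (A : Matrix (Fin n) (Fin n) ℝ)
    (B : Matrix (Fin n) (Fin m) ℝ) (u : ℝ → Fin m → ℝ) {t : ℝ} (ht : 0 < t) :
    ∀ᵐ s : ℝ, s ∈ uIoc 0 t →
      forcingIntegrand α ρ A B u t s = mlKer ρ α (matCLM A) α (t - s) (B *ᵥ u s) := by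
  filter_upwards [(by simp [ae_iff] : ∀ᵐ x : ℝ, x ≠ t)] with s hs hst
  rw [uIoc_of_le ht.le] at hst
  rw [mlKer_matCLM_apply ρ hα hα A (sub_pos.2 (lt_of_le_of_ne hst.2 hs)), forcingIntegrand]

lemma intervalIntegrable_forcingIntegrand_iff (hα : 0 < α) (A : Matrix (Fin n) (Fin n) ℝ)
    (B : Matrix (Fin n) (Fin m) ℝ) (u : ℝ → Fin m → ℝ) {t : ℝ} (ht : 0 < t) :
    IntervalIntegrable (forcingIntegrand α ρ A B u t) volume 0 t ↔
      ConvAt (mlKer ρ α (matCLM A) α) (fun s => B *ᵥ u s) t :=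
  intervalIntegrable_congr_ae
    ((ae_restrict_iff' measurableSet_uIoc).2 (forcingIntegrand_eq hα A B u ht))

lemma solutionFormula_eq (hα : 0 < α) (A : Matrix (Fin n) (Fin n) ℝ)
    (B : Matrix (Fin n) (Fin m) ℝ) (u : ℝ → Fin m → ℝ) (y₀ : Fin n → ℝ) {t : ℝ} (ht : 0 < t) :
    solutionFormula α ρ A B u y₀ t = mlKer ρ α (matCLM A) 1 t y₀
      + conv (mlKer ρ α (matCLM A) α) (fun s => B *ᵥ u s) t := by
  rw [solutionFormula, conv, integral_congr_ae (forcingIntegrand_eq hα A B u ht),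
    mlKer_matCLM_apply ρ hα one_pos A ht, sub_self, Real.rpow_zero, mul_one]
  rfl

/-- The nonzero factor `1/Γ(1-α)` moves inside the integral, and `-α = (1-α) - 1`. -/
lemma hasCaputoTempered_iff (hα : α < 1) (v : ℝ → Fin n → ℝ) (d : Fin n → ℝ) {t : ℝ}
    (ht : 0 < t) : HasCaputoTempered α ρ v t d ↔
      ConvAt (powOp (Fin n → ℝ) ρ (1 - α)) (temperedDeriv ρ v) t ∧
      conv (powOp (Fin n → ℝ) ρ (1 - α)) (temperedDeriv ρ v) t = d := by
  have hG : Real.Gamma (1 - α) ≠ 0 := (Real.Gamma_pos_of_pos (sub_pos.2 hα)).ne'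
  have e : ∀ᵐ s : ℝ, s ∈ uIoc 0 t → (Real.Gamma (1 - α))⁻¹ • caputoIntegrand α ρ v t s
      = powOp (Fin n → ℝ) ρ (1 - α) (t - s) (temperedDeriv ρ v s) := by
    filter_upwards [(by simp [ae_iff] : ∀ᵐ x : ℝ, x ≠ t)] with s hs hst
    rw [uIoc_of_le ht.le] at hst
    rw [powOp_apply, powKer_of_pos _ _ (sub_pos.2 (lt_of_le_of_ne hst.2 hs)), caputoIntegrand,
      smul_smul, sub_sub_cancel_left]
    congr 1
    ring
  have e' := intervalIntegrable_congr_ae (μ := volume)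
    ((ae_restrict_iff' measurableSet_uIoc).2 e)
  rw [HasCaputoTempered, caputoTempered, ← intervalIntegral.integral_smul,
    integral_congr_ae e, ConvAt, ← e']
  refine and_congr_left fun _ => ⟨fun h => h.smul (Real.Gamma (1 - α))⁻¹, fun h => ?_⟩
  refine (h.smul (Real.Gamma (1 - α))).congr fun s _ => ?_
  simp [smul_smul, hG]

lemma AbsolutelyContinuousOnInterval.eq_conv_temperedDeriv {y : ℝ → Fin n → ℝ} (ρ : ℝ)
    (hy : AbsolutelyContinuousOnInterval y 0 T) :
    IntervalIntegrable (temperedDeriv ρ y) volume 0 T ∧ ∀ t ∈ Ioc 0 T,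
      y t = powOp (Fin n → ℝ) ρ 1 t (y 0)
        + conv (powOp (Fin n → ℝ) ρ 1) (temperedDeriv ρ y) t := by
  obtain ⟨h1, h2⟩ := AbsolutelyContinuousOnInterval.eq_integral_temperedDeriv ρ hy
  refine ⟨h1, fun t ht => ?_⟩
  rw [conv_powOp_one _ ht.1.le, powOp_apply, powKer_one ρ ht.1]
  exact h2 t (Ioc_subset_Icc_self ht)

lemma intervalIntegrable_mulVec {u : ℝ → Fin m → ℝ} {a b : ℝ} (B : Matrix (Fin n) (Fin m) ℝ)
    (hu : IntervalIntegrable u volume a b) :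
    IntervalIntegrable (fun s => B *ᵥ u s) volume a b := by
  simp only [← matCLM_apply]
  exact ⟨(matCLM B).integrable_comp hu.1, (matCLM B).integrable_comp hu.2⟩

lemma ae_restrict_Icc_iff {p : ℝ → Prop} (T : ℝ) :
    (∀ᵐ t ∂(volume.restrict (Icc 0 T)), p t) ↔ ∀ᵐ t : ℝ, t ∈ Ioc 0 T → p t := by
  rw [← ae_restrict_iff' measurableSet_Ioc, Measure.restrict_congr_set Ioc_ae_eq_Icc]

lemma IsSolution.eq_solutionFormula (hα : α ∈ Ioo (0 : ℝ) 1) (hρ : 0 ≤ ρ)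
    {A : Matrix (Fin n) (Fin n) ℝ} {B : Matrix (Fin n) (Fin m) ℝ} {u : ℝ → Fin m → ℝ}
    {y₀ : Fin n → ℝ} {y : ℝ → Fin n → ℝ} (hy : IsSolution α ρ T A B u y₀ y) {t : ℝ}
    (ht : t ∈ Icc 0 T) :
    IntervalIntegrable (forcingIntegrand α ρ A B u t) volume 0 t ∧
      y t = solutionFormula α ρ A B u y₀ t := by
  -- The kernels are set to `0` at `x = 0`, so the kernel form of the formula is available only for
  -- `t > 0`.
  rcases ht.1.eq_or_lt with rfl | ht0
  · exact ⟨IntervalIntegrable.refl, by rw [solutionFormula_zero hα.1, hy.initial]⟩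
  have htT : t ∈ Ioc 0 T := ⟨ht0, ht.2⟩
  obtain ⟨hf, hrep⟩ :=
    AbsolutelyContinuousOnInterval.eq_conv_temperedDeriv ρ hy.absolutelyContinuous
  rw [hy.initial] at hrep
  obtain ⟨h1, h2, h3⟩ := conv_mlKer_conv_powOp hρ hα.1 hα.2 (matCLM A) hf hrep htT
  have hg : ∀ᵐ s : ℝ, s ∈ Ioc 0 T → conv (powOp (Fin n → ℝ) ρ (1 - α)) (temperedDeriv ρ y) s
      - matCLM A (y s) = B *ᵥ u s := by
    filter_upwards [(ae_restrict_Icc_iff T).1 hy.equation] with s hs hsT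
    rw [((hasCaputoTempered_iff hα.2 y _ hsT.1).1 (hs hsT)).2, matCLM_apply, add_sub_cancel_left]
  rw [intervalIntegrable_forcingIntegrand_iff hα.1 A B u ht0, solutionFormula_eq hα.1 A B u y₀ ht0]
  refine ⟨(h1.sub h2).congr_ae htT hg, ?_⟩
  rw [← conv_congr_ae _ htT hg, conv_sub h1 h2, h3]
  abel

lemma isSolution_of_eq_solutionFormula (hα : α ∈ Ioo (0 : ℝ) 1) (hρ : 0 ≤ ρ) (hT : 0 < T)
    {A : Matrix (Fin n) (Fin n) ℝ} {B : Matrix (Fin n) (Fin m) ℝ} {u : ℝ → Fin m → ℝ}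
    (hu : IntervalIntegrable u volume 0 T) {y₀ : Fin n → ℝ} {y : ℝ → Fin n → ℝ}
    (hac : AbsolutelyContinuousOnInterval y 0 T)
    (hy : ∀ t ∈ Icc 0 T, IntervalIntegrable (forcingIntegrand α ρ A B u t) volume 0 t ∧
      y t = solutionFormula α ρ A B u y₀ t) : IsSolution α ρ T A B u y₀ y := by
  have hy0 : y 0 = y₀ := by rw [(hy 0 (left_mem_Icc.2 hT.le)).2, solutionFormula_zero hα.1]
  obtain ⟨hf, hrep⟩ := AbsolutelyContinuousOnInterval.eq_conv_temperedDeriv ρ hac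
  rw [hy0] at hrep
  have h1α : 0 < 1 - α := sub_pos.2 hα.2
  obtain ⟨hcI, hcAe⟩ := intervalIntegrable_conv hT.le (stronglyMeasurable_powOp ρ (1 - α))
    (fun x hx => by rw [powOp, powKer_of_nonpos _ _ hx, zero_smul])
    (intervalIntegrable_powOp ρ h1α hT) hf
  have hAy : IntervalIntegrable (fun s => matCLM A (y s)) volume 0 T := by
    simpa only [matCLM_apply] using intervalIntegrable_mulVec A hac.continuousOn.intervalIntegrable
  -- The residual of the equation is integrable and is annihilated by convolution with `E_α`.
  have hr := ae_eq_zero_of_conv_mlKer_eq_zero hρ hα.1 hα.2 hT (matCLM A)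
    ((hcI.sub hAy).sub (intervalIntegrable_mulVec B hu)) fun t ht => by
      obtain ⟨h1, h2, h3⟩ := conv_mlKer_conv_powOp hρ hα.1 hα.2 (matCLM A) hf hrep ht
      obtain ⟨h4, h5⟩ := hy t (Ioc_subset_Icc_self ht)
      rw [intervalIntegrable_forcingIntegrand_iff hα.1 A B u ht.1] at h4
      rw [solutionFormula_eq hα.1 A B u y₀ ht.1] at h5
      refine (conv_sub (h1.sub h2) h4).trans ?_
      rw [conv_sub h1 h2, h3, h5]
      abel
  refine ⟨hac, hy0, (ae_restrict_Icc_iff T).2 ?_⟩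
  filter_upwards [hcAe, hr] with t ht1 ht2 ht
  refine (hasCaputoTempered_iff hα.2 y _ ht.1).2 ⟨ht1 ht, ?_⟩
  have := ht2 ht
  rw [sub_sub, sub_eq_zero, matCLM_apply] at this
  exact this

lemma solutionFormula_of_absolutelyContinuous (hα : α ∈ Ioo (0 : ℝ) 1) (hρ : 0 ≤ ρ) (hT : 0 < T)
    (A : Matrix (Fin n) (Fin n) ℝ) (B : Matrix (Fin n) (Fin m) ℝ) {u : ℝ → Fin m → ℝ}
    (hu : AbsolutelyContinuousOnInterval u 0 T) (y₀ : Fin n → ℝ) :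
    AbsolutelyContinuousOnInterval (solutionFormula α ρ A B u y₀) 0 T ∧
      ∀ t ∈ Ioc 0 T, HasCaputoTempered α ρ (solutionFormula α ρ A B u y₀) t
        (A *ᵥ solutionFormula α ρ A B u y₀ t + B *ᵥ u t) := by
  have hg : AbsolutelyContinuousOnInterval (fun t => B *ᵥ u t) 0 T := by
    simpa only [matCLM_apply] using
      AbsolutelyContinuousOnInterval.lipschitz_comp hu (matCLM B).lipschitz
  obtain ⟨hφ, hrep⟩ := AbsolutelyContinuousOnInterval.eq_conv_temperedDeriv ρ hg
  -- `F` is the candidate for `D y`, found by solving `E_1 y₀ + E_α * Bu = k_1 y₀ + k_1 * F`.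
  obtain ⟨F, hF⟩ : ∃ F, F = fun s => mlKer ρ α (matCLM A) α s (matCLM A y₀ + B *ᵥ u 0)
    + conv (mlKer ρ α (matCLM A) α) (temperedDeriv ρ fun t => B *ᵥ u t) s := ⟨_, rfl⟩
  have hFint : IntervalIntegrable F volume 0 T :=
    hF ▸ intervalIntegrable_mlKer_apply_add_conv ρ hα.1 hT (matCLM A) hφ _
  have key := fun t (ht : t ∈ Ioc 0 T) =>
    conv_mlKer_of_eq_conv_powOp (y₀ := y₀) hρ hα.1 hα.2 (matCLM A) hφ hrep hF ht
  obtain ⟨hac, hd⟩ := temperedDeriv_of_eq_integral (y := solutionFormula α ρ A B u y₀) (y₀ := y₀)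
    ρ hT.le hFint fun t ht => by
      rcases ht.1.eq_or_lt with rfl | ht0
      · simp [solutionFormula_zero hα.1]
      · rw [solutionFormula_eq hα.1 A B u y₀ ht0, (key t ⟨ht0, ht.2⟩).1, conv_powOp_one _ ht.1,
          powOp_apply, powKer_one ρ ht0]
  refine ⟨hac, fun t ht => (hasCaputoTempered_iff hα.2 _ _ ht.1).2 ?_⟩
  -- The Caputo integral sees `D y` only up to null sets, so the identity for `F` yields the
  -- equation at every `t > 0`.
  have hd' : ∀ᵐ s : ℝ, s ∈ Ioc 0 T → F s = temperedDeriv ρ (solutionFormula α ρ A B u y₀) s := by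
    filter_upwards [hd] with s hs hsT using (hs hsT).symm
  obtain ⟨-, h2, h3⟩ := key t ht
  refine ⟨h2.congr_ae ht hd', ?_⟩
  rw [← conv_congr_ae _ ht hd', h3, ← solutionFormula_eq hα.1 A B u y₀ ht.1, matCLM_apply]

end

end TemperedFractional

theorem theorem1 {n m : ℕ} (α ρ T : ℝ) (hα : α ∈ Set.Ioo (0 : ℝ) 1) (hρ : 0 < ρ) (hT : 0 < T)
    (A : Matrix (Fin n) (Fin n) ℝ) (B : Matrix (Fin n) (Fin m) ℝ)
    (hdet : ∀ᶠ s : ℝ in Filter.atTop,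
      ((s + ρ) ^ α • (1 : Matrix (Fin n) (Fin n) ℝ) - A).det ≠ 0)
    (y₀ : Fin n → ℝ) (u : ℝ → Fin m → ℝ) (hu : IntervalIntegrable u volume 0 T) :
    (∀ y : ℝ → Fin n → ℝ,
      TemperedFractional.IsSolution α ρ T A B u y₀ y ↔
        AbsolutelyContinuousOnInterval y 0 T ∧
          ∀ t ∈ Set.Icc 0 T,
            IntervalIntegrable (TemperedFractional.forcingIntegrand α ρ A B u t) volume 0 t ∧
              y t = TemperedFractional.solutionFormula α ρ A B u y₀ t) ∧
    (AbsolutelyContinuousOnInterval u 0 T →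
      TemperedFractional.IsSolution α ρ T A B u y₀
          (TemperedFractional.solutionFormula α ρ A B u y₀) ∧
        ∀ t ∈ Set.Ioc 0 T,
          TemperedFractional.HasCaputoTempered α ρ
            (TemperedFractional.solutionFormula α ρ A B u y₀) t
            (A *ᵥ TemperedFractional.solutionFormula α ρ A B u y₀ t + B *ᵥ u t)) := by
  refine ⟨fun y => ⟨fun h => ⟨h.absolutelyContinuous, fun t ht => h.eq_solutionFormula hα hρ.le ht⟩,
    fun h => TemperedFractional.isSolution_of_eq_solutionFormula hα hρ.le hT hu h.1 h.2⟩,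
    fun hac => ?_⟩
  obtain ⟨h1, h2⟩ :=
    TemperedFractional.solutionFormula_of_absolutelyContinuous hα hρ.le hT A B hac y₀
  refine ⟨⟨h1, TemperedFractional.solutionFormula_zero hα.1 A B u y₀, ?_⟩, h2⟩
  exact (TemperedFractional.ae_restrict_Icc_iff T).2 (Filter.Eventually.of_forall h2)
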